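/- **Setting.** Let $\mathcal X_d\subseteq\mathbb R^d$ be a (compact or unbounded, e.g. $\mathcal X_d=\mathbb R^d$) set that is the closure of its interior and has a Lebesgue-null boundary, and let $\mathcal X_m\subset\mathbb R^m$ be compact. Let $k_1,k_2$ be scalar kernels (symmetric, positive semidefinite) on $\mathcal X_d$ and $\mathcal X_m$. Let $\mathcal H_K$ be the reproducing kernel Hilbert space (RKHS) of functions $\mathcal X_d\times\mathcal X_m\to\mathbb R^d$ with kernel $K((\mathbf x,\beta),(\mathbf x',\beta'))=k_1(\mathbf x,\mathbf x')k_2(\beta,\beta')\mathbf I_d$ and norm $\|\cdot\|_K$, and let $\mathcal H_1^d$ be the RKHS of functions $\mathcal X_d\to\mathbb R^d$ with kernel $k_1\mathbf I_d$. Let $K^*_{(\mathbf x,\beta)}\colon\mathcal H_K\to\mathbb R^d$ be the evaluation $\mathbf s\mapsto\mathbf s(\mathbf x;\beta)$ and $K_{(\mathbf x,\beta)}$ its adjoint. For every $\beta\in\mathcal X_m$ let $p_0(\cdot;\beta)$ be a probability density on $\mathcal X_d$ that is continuous on $\mathcal X_d$, positive and differentiable in the interior, with $p_0(\mathbf x;\beta)\to0$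 as $\|\mathbf x\|_2\to\infty$ in $\mathcal X_d$ and $p_0(\mathbf x;\beta)\,k_1(\mathbf x,\mathbf x)=0$ at every boundary point $\mathbf x$ of $\mathcal X_d$. Let the score $\mathbf s_0(\mathbf x;\beta)=\nabla_{\mathbf x}\log p_0(\mathbf x;\beta)$ belong to $\mathcal H_K$ (that is, let it agree on $\operatorname{int}\mathcal X_d\times\mathcal X_m$ with an element of $\mathcal H_K$, again called $\mathbf s_0$). For every $n$ let $\beta_1,\dots,\beta_n\in\mathcal X_m$ be latent vectors (which may depend on $n$), let $\mathbf x_1,\dots,\mathbf x_n$ be independent with $\mathbf x_i\sim p_0(\cdot;\beta_i)$, and let $\widehat\beta_1,\dots,\widehat\beta_n$ be $\mathcal X_m$-valued estimates of the latent vectors, with an arbitrary dependence on the data. Write $\mathbf B$, $\widehat{\mathbf B}$ for the matrices with rows $\beta_i$, $\widehat\beta_i$. For $\lambda>0$ the kernel score-matching estimator is $$\widehat{\mathbf s}_\lambda=\operatorname*{argmin}_{\mathbf s\in\mathcal H_K}\ \frac1n\sum_{i=1}^n\Big(\tfrac12\|\mathbf s(\mathbf x_i;\widehat\beta_i)\|_2^2+\operatorname{tr}\big(\nabla_{\mathbf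 x}\mathbf s(\mathbf x_i;\widehat\beta_i)\big)\Big)+\frac\lambda2\|\mathbf s\|_K^2 .$$ **Theorem 1.** Assume: 1. $\|\widehat{\mathbf B}-\mathbf B\|_{2,\infty}=\max_{i}\|\widehat\beta_i-\beta_i\|_2=o_p(1)$. 2. $k_1$ is twice continuously differentiable on $\mathcal X_d\times\mathcal X_d$, $k_2$ is four times continuously differentiable on $\mathcal X_m\times\mathcal X_m$, and there are constants $\kappa_1,\kappa_3$ with $k_1(\mathbf x,\mathbf x)\le\kappa_1$ for $\mathbf x\in\mathcal X_d$ and $\partial_{x_j}\partial_{x'_j}k_1(\mathbf x,\mathbf x')\le\kappa_3$ for all $j$ and all $\mathbf x,\mathbf x'$ in the interior of $\mathcal X_d$. 3. The operators $C_{\mathbf B}=\frac1n\sum_{i=1}^n\mathbb E_{\mathbf X\sim p_0(\cdot;\beta_i)}\big[K_{(\mathbf X,\beta_i)}K^*_{(\mathbf X,\beta_i)}\big]$ on $\mathcal H_K$ converge in operator norm, as $n\to\infty$, to a compact, self-adjoint, positive semidefinite operator $C$; and $P_{\mathbf B}(I-P)\to0$ in the strong operator topology, where $P_{\mathbf B}$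 and $P$ are the orthogonal projections onto $\overline{\operatorname{Ran}(C_{\mathbf B})}$ and $\overline{\operatorname{Ran}(C)}$. Then there is a deterministic sequence $\lambda_n>0$ with $\lambda_n\to0$ such that, for every $n$, the estimator $\widehat{\mathbf s}_{\lambda_n}$ almost surely exists and is unique, and $$\sup_{i\in[n]}\big\|\widehat{\mathbf s}_{\lambda_n}(\cdot;\widehat\beta_i)-\mathbf s_0(\cdot;\beta_i)\big\|_{\mathcal H_1^d}=o_p(1).$$ -/

import Mathlib

open Filter MeasureTheory ProbabilityTheory Topology
open scoped ENNReal

noncomputable section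

/-- `d`-dimensional Euclidean space. -/
abbrev Euc (d : ℕ) : Type := EuclideanSpace ℝ (Fin d)

/-- The partial derivative `∂_j f` at `x`. -/
def partialDeriv {d : ℕ} (j : Fin d) (f : Euc d → ℝ) (x : Euc d) : ℝ :=
  lineDeriv ℝ f x (EuclideanSpace.single j 1)

/-- The trace of the Jacobian, `∑ j, ∂_j (e_jᵀ f)`, at `x` of a function `f` that is given on
the set `S`. Only points `x` in the interior of `S` matter; there the values outside `S` (put to
zero) play no role. -/
def divergence {d : ℕ} {S : Set (Euc d)} (f : S → Euc d) (x : Euc d) : ℝ :=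
  ∑ j, partialDeriv j (fun y => Function.extend Subtype.val f 0 y j) x

/-- `k` is a (symmetric, positive semidefinite) scalar kernel on `S`. -/
def IsKernelOn {d : ℕ} (S : Set (Euc d)) (k : Euc d → Euc d → ℝ) : Prop :=
  (Matrix.of fun x y : S => k x y).PosSemidef

/-- Smoothness and boundedness of the two scalar kernels. For a compact `T` the bounds on `k₂` and
on its derivatives need not be asked for. -/
structure KernelRegularity {d m : ℕ} (S : Set (Euc d)) (T : Set (Euc m))
    (k₁ : Euc d → Euc d → ℝ) (k₂ : Euc m → Euc m → ℝ) : Prop where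
  contDiffOn_fst : ContDiffOn ℝ 2 (fun z : Euc d × Euc d => k₁ z.1 z.2) (S ×ˢ S)
  contDiffOn_snd : ContDiffOn ℝ 4 (fun z : Euc m × Euc m => k₂ z.1 z.2) (T ×ˢ T)
  bdd_fst : ∃ κ₁ : ℝ, ∀ x ∈ S, k₁ x x ≤ κ₁
  bdd_deriv_fst : ∃ κ₃ : ℝ, ∀ j, ∀ x ∈ interior S, ∀ x' ∈ interior S,
    partialDeriv j (fun y => partialDeriv j (fun y' => k₁ y y') x') x ≤ κ₃

/-- The distribution on `S` with Lebesgue density `p (·; β)`. -/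
def densityMeasure {d m : ℕ} (S : Set (Euc d)) (p : Euc d → Euc m → ℝ) (β : Euc m) : Measure S :=
  ((volume : Measure (Euc d)).comap Subtype.val).withDensity fun x => ENNReal.ofReal (p x β)

/-- `p (·; β)`, `β ∈ T`, are probability densities on `S`, continuous on `S`, positive and
differentiable in the interior, that decay at infinity, and at each boundary point of `S` either
the density or (all functions of the RKHS of) the kernel `k₁` vanishes. -/
structure DensityRegularity {d m : ℕ} (S : Set (Euc d)) (T : Set (Euc m))
    (k₁ : Euc d → Euc d → ℝ) (p : Euc d → Euc m → ℝ) : Prop where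
  continuousOn : ∀ β ∈ T, ContinuousOn (fun x => p x β) S
  pos : ∀ β ∈ T, ∀ x ∈ interior S, 0 < p x β
  differentiableOn : ∀ β ∈ T, DifferentiableOn ℝ (fun x => p x β) (interior S)
  isProb : ∀ β ∈ T, IsProbabilityMeasure (densityMeasure S p β)
  decay : ∀ β ∈ T, Tendsto (fun x => p x β) (Bornology.cobounded (Euc d) ⊓ 𝓟 S) (𝓝 0)
  boundary : ∀ β ∈ T, ∀ x ∈ frontier S, p x β * k₁ x x = 0

/-- The Stein score `∇_x log p(x; β)`. -/
def steinScore {d m : ℕ} (p : Euc d → Euc m → ℝ) (x : Euc d) (β : Euc m) : Euc d :=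
  gradient (fun y => Real.log (p y β)) x

section Estimator

variable {d m : ℕ} {S : Set (Euc d)} {T : Set (Euc m)}
variable {H : Type*} [NormedAddCommGroup H] [InnerProductSpace ℝ H] [RKHS ℝ H (S × T) (Euc d)]

/-- The regularised empirical score-matching objective. -/
def scoreObjective {n : ℕ} (lam : ℝ) (x : Fin n → S) (b : Fin n → T) (s : H) : ℝ :=
  (1 / (n : ℝ)) * ∑ i, ((1 / 2) * ‖s (x i, b i)‖ ^ 2 + divergence (fun y => s (y, b i)) (x i))
    + lam / 2 * ‖s‖ ^ 2

/-- `s` minimises the regularised empirical score-matching objective over the whole space. -/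
def IsScoreMinimizer {n : ℕ} (lam : ℝ) (x : Fin n → S) (b : Fin n → T) (s : H) : Prop :=
  ∀ t : H, scoreObjective lam x b s ≤ scoreObjective lam x b t

variable (H) in
/-- The kernel score-matching estimator: the minimiser of the objective. -/
def scoreEstimator {n : ℕ} (lam : ℝ) (x : Fin n → S) (b : Fin n → T) : H :=
  Classical.epsilon fun s : H => IsScoreMinimizer lam x b s

variable (H) in
/-- The operator `C_B = n⁻¹ ∑ i, E_{β_i} [K_{(X, β_i)} K*_{(X, β_i)}]` on `H`. -/
def covOperator [CompleteSpace H] {n : ℕ} (p : Euc d → Euc m → ℝ) (B : Fin n → T) : H →L[ℝ] H :=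
  (1 / (n : ℝ)) • ∑ i, ∫ x : S,
    (RKHS.kerFun H (x, B i)).comp (ContinuousLinearMap.adjoint (RKHS.kerFun H (x, B i)))
      ∂(densityMeasure S p (B i))

end Estimator

/-- The orthogonal projection onto the closure of the range of `A`. -/
def rangeProj {H : Type*} [NormedAddCommGroup H] [InnerProductSpace ℝ H] [CompleteSpace H]
    (A : H →L[ℝ] H) : H →L[ℝ] H :=
  (LinearMap.range A.toLinearMap).topologicalClosure.starProjection

/-- The norm of a function `f` in the reproducing kernel Hilbert space `H`; it is `∞` if `f` does
not belong to `H`. -/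
def rkhsNorm {X V : Type*} [NormedAddCommGroup V] [InnerProductSpace ℝ V] (H : Type*)
    [NormedAddCommGroup H] [InnerProductSpace ℝ H] [RKHS ℝ H X V] (f : X → V) : ℝ≥0∞ :=
  ⨅ (h : H) (_ : ⇑h = f), ‖h‖ₑ

/-- The `(2, ∞)`-norm of a matrix with rows `M i`. -/
def twoInftyNorm {n m : ℕ} (M : Fin n → Euc m) : ℝ≥0∞ := ⨆ i, ‖M i‖ₑ

/-- `Y n = o_p(1)` for nonnegative `Y n` on probability spaces `Ω n`. -/
def IsLittleOp {Ω : ℕ → Type*} [∀ n, MeasurableSpace (Ω n)] (P : ∀ n, Measure (Ω n))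
    (Y : ∀ n, Ω n → ℝ≥0∞) : Prop :=
  ∀ ε : ℝ≥0∞, 0 < ε → Tendsto (fun n => P n {ω | ε ≤ Y n ω}) atTop (𝓝 0)

end

/-! Write `V_β : H₁ → H` for the map sending the kernel function at `x` to the one at `(x, β)`. Its
adjoint is the slice `s ↦ s(·, β)`, and `⟪V_β f, V_β' g⟫ = k₂(β, β') ⟪f, g⟫`. Hence an error in a
latent vector costs only the operator norm of `V_β - V_β'`, which is at most the kernel distance of
`β` and `β'`, uniformly in `x` (`IsProductKernel.norm_sliceEmb_sub_le`).

The divergence at an interior point is a bounded functional, so the objective is quadratic and its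
minimiser solves `Ĉ t + λ t = -ξ̂`, with empirical covariance `Ĉ` and mean divergence representer
`ξ̂`. Stein's identity (`setIntegral_stein`) says that the gradient of the loss is centred at `s₀`.
The population analogue is therefore `C_B s + λ s = C_B s₀`, whose solution is deterministic with
`‖s‖ ≤ 2‖s₀‖`.

Stochastic error: putting `s` into the empirical equation leaves a mean of centred, bounded,
independent terms, which has order `n^(-1/2)`, and the effect of replacing `β_i` by its estimate, of
the order of the maximal kernel distance. As `λ (Ĉ + λ)⁻¹` is a contraction, `λ‖t - s‖` is at most
the sum of the two (`BoundedKernels.norm_estimator_sub_le`). Since the kernel distance is `o_p(1)`,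
some deterministic `λ → 0` is slow enough to dominate both (`IsLittleOp.exists_rate`).

Bias: `s` need not approach `s₀`, only its projection `P_B s₀` onto the closed range of `C_B`
(`tendsto_norm_regularised_sub_rangeProj`). This suffices: an element of the kernel of `C_B` has
vanishing slices at every `β_i`, so `P_B s₀` and `s₀` have the same slices there
(`BoundedKernels.coe_eq_zero_of_covOperator_eq_zero`). Bounded slicing then turns convergence in `H`
into uniform convergence over `i` in `H₁`. -/

noncomputable section

/-! ### Truncation, and a divergence theorem without boundary regularity. -/

/-- A smooth function vanishing near `0` whose rescalings `r⁻¹ φ (r u)` tend to `u`. -/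
def cutoff (u : ℝ) : ℝ := u * Real.smoothTransition (u ^ 2 - 1)

lemma contDiff_cutoff : ContDiff ℝ 1 cutoff :=
  contDiff_id.mul (Real.smoothTransition.contDiff.comp ((contDiff_id.pow 2).sub contDiff_const))

lemma cutoff_of_abs_le {u : ℝ} (hu : |u| ≤ 1) : cutoff u = 0 := by
  have : u ^ 2 - 1 ≤ 0 := by
    have := (sq_le_one_iff_abs_le_one u).2 hu
    linarith
  simp [cutoff, Real.smoothTransition.zero_of_nonpos this]

lemma deriv_cutoff_of_two_lt_abs {u : ℝ} (hu : 2 < |u|) : deriv cutoff u = 1 := by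
  have h : cutoff =ᶠ[𝓝 u] id := by
    filter_upwards [continuous_abs.continuousAt.eventually (lt_mem_nhds hu)] with w hw
    have : 1 ≤ w ^ 2 - 1 := by
      have := sq_abs w
      nlinarith
    simp [cutoff, Real.smoothTransition.one_of_one_le this]
  rw [h.deriv_eq, deriv_id]

lemma exists_bound_deriv_cutoff : ∃ M, 0 ≤ M ∧ ∀ u, |deriv cutoff u| ≤ M := by
  have hc : Continuous (deriv cutoff) := contDiff_cutoff.continuous_deriv le_rfl
  obtain ⟨M, hM⟩ := (isCompact_Icc (a := (-2 : ℝ)) (b := 2)).exists_bound_of_continuousOn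
    hc.continuousOn
  refine ⟨max M 1, by positivity, fun u => ?_⟩
  by_cases hu : 2 < |u|
  · simp [deriv_cutoff_of_two_lt_abs hu]
  · exact (hM u (abs_le.1 (not_lt.1 hu))).trans (le_max_left _ _)

lemma hasDerivAt_cutoff (u : ℝ) : HasDerivAt cutoff (deriv cutoff u) u :=
  (contDiff_cutoff.differentiable one_ne_zero u).hasDerivAt

/-- Near a zero with nonzero derivative there is no other zero. Such zeros are thus isolated from
the right, which already forces countability. -/
lemma countable_setOf_zero_of_deriv_ne_zero (g : ℝ → ℝ) :
    {t | g t = 0 ∧ ∃ g', g' ≠ 0 ∧ HasDerivAt g g' t}.Countable := by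
  refine (countable_setOfPred_isolated_right_within
    (s := {t | g t = 0 ∧ ∃ g', g' ≠ 0 ∧ HasDerivAt g g' t})).mono ?_
  rintro t ⟨h0, g', hg', hd⟩
  refine ⟨⟨h0, g', hg', hd⟩, ?_⟩
  have h1 : ∀ᶠ z in 𝓝[≠] t, g z ≠ 0 := hd.eventually_ne hg'
  have h2 : ∀ᶠ z in 𝓝[>] t, g z ≠ 0 := h1.filter_mono (nhdsWithin_mono _ fun z hz => ne_of_gt hz)
  refine Filter.empty_mem_iff_bot.1 ?_
  rw [Set.inter_comm, nhdsWithin_inter']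
  filter_upwards [h2.filter_mono inf_le_left, mem_inf_of_right (mem_principal_self _)] with z hz hz'
  exact hz hz'.1

section LineDeriv

variable {E : Type*} [NormedAddCommGroup E] [NormedSpace ℝ E] [MeasurableSpace E] [BorelSpace E]
  [FiniteDimensional ℝ E] (μ : Measure E) [μ.IsAddHaarMeasure]

/-- Almost everywhere on its zero set a function has vanishing line derivative. -/
lemma ae_lineDeriv_eq_zero_of_eq_zero {f : E → ℝ} (hf : Continuous f) (v : E) :
    ∀ᵐ x ∂μ, f x = 0 → lineDeriv ℝ f x v = 0 := by
  have hm : MeasurableSet {x | f x = 0 → lineDeriv ℝ f x v = 0} := by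
    have h1 : MeasurableSet {x | f x = 0} := hf.measurable (measurableSet_singleton 0)
    have h2 : MeasurableSet {x | lineDeriv ℝ f x v = 0} :=
      measurable_lineDeriv hf (measurableSet_singleton 0)
    exact h1.imp h2
  -- Fubini along the direction `v`: it suffices that on each line almost every parameter is good.
  have key := ae_mem_of_ae_add_linearMap_mem (LinearMap.toSpanSingleton ℝ E v) volume μ hm
  refine key fun y => ?_
  have hc := countable_setOf_zero_of_deriv_ne_zero fun t : ℝ => f (y + t • v)
  filter_upwards [hc.ae_notMem volume] with t ht h0
  by_contra h1
  refine ht ⟨by simpa using h0, _, h1, ?_⟩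
  -- `lineDeriv` is zero where there is no derivative, so a nonzero value forces differentiability.
  have hd : LineDifferentiableAt ℝ f (y + t • v) v := by
    by_contra h
    exact h1 (by simpa using lineDeriv_zero_of_not_lineDifferentiableAt h)
  have := hd.hasLineDerivAt
  simp only [LinearMap.toSpanSingleton_apply]
  unfold HasLineDerivAt at this
  have h3 := HasDerivAt.scomp_of_eq t this ((hasDerivAt_id t).sub_const t) (by simp)
  simpa [Function.comp_def, add_assoc, ← add_smul] using h3

/-- The integral over an open set of a line derivative of a function that vanishes at the boundary
and at infinity is zero. -/
theorem setIntegral_lineDeriv_eq_zero {U : Set E} (hU : IsOpen U) {f f' : E → ℝ} {v : E}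
    (hf : Continuous f) (hf0 : ∀ x ∉ U, f x = 0) (hinf : Tendsto f (cocompact E) (𝓝 0))
    (hd : ∀ x ∈ U, HasLineDerivAt ℝ f (f' x) x v) (hint : IntegrableOn f' U μ) :
    ∫ x in U, f' x ∂μ = 0 := by
  obtain ⟨M, hM0, hM⟩ := exists_bound_deriv_cutoff
  -- The derivative of the truncation `cutoff ((n + 1) f) / (n + 1)`: the factor `n + 1` from the
  -- chain rule cancels, which leaves the dominating function `M |f'|`.
  set F' : ℕ → E → ℝ := fun n x => U.indicator (fun x => deriv cutoff ((n + 1) * f x) * f' x) x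
  have hi : Integrable (U.indicator f') μ := hint.integrable_indicator hU.measurableSet
  have hF'eq : ∀ n x, F' n x = deriv cutoff ((n + 1) * f x) * U.indicator f' x := by
    intro n x
    simp only [F', Set.indicator]
    split_ifs <;> simp
  have hcd : Continuous (deriv cutoff) := contDiff_cutoff.continuous_deriv le_rfl
  have hmeas : ∀ n, AEStronglyMeasurable (F' n) μ := by
    intro n
    have : F' n = fun x => deriv cutoff ((n + 1) * f x) * U.indicator f' x := funext (hF'eq n)
    rw [this]
    exact (hcd.comp (continuous_const.mul hf)).aestronglyMeasurable.mul hi.1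
  have hbd : ∀ n x, ‖F' n x‖ ≤ M * ‖U.indicator f' x‖ := by
    intro n x
    rw [hF'eq, norm_mul]
    exact mul_le_mul_of_nonneg_right (hM _) (norm_nonneg _)
  have hF'int : ∀ n, Integrable (F' n) μ := fun n =>
    (hi.norm.const_mul M).mono' (hmeas n) (ae_of_all _ (hbd n))
  -- the truncations have compact support and integral zero derivative
  have hzero : ∀ n, ∫ x, F' n x ∂μ = 0 := by
    intro n
    have hn : (0 : ℝ) < n + 1 := by positivity
    set F : E → ℝ := fun x => cutoff ((n + 1) * f x) / (n + 1) with hF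
    have hFc : Continuous F :=
      (contDiff_cutoff.continuous.comp (continuous_const.mul hf)).div_const _
    have hsmall : ∀ x, |f x| < 1 / (n + 1) → F x = 0 := by
      intro x hx
      have : |(n + 1) * f x| ≤ 1 := by
        rw [abs_mul, abs_of_pos hn]
        rw [lt_div_iff₀ hn] at hx
        linarith
      simp [hF, cutoff_of_abs_le this]
    have hcs : HasCompactSupport F := by
      rw [hasCompactSupport_iff_eventuallyEq]
      have h1 : ∀ᶠ x in cocompact E, |f x| < 1 / (n + 1) := by
        have := hinf.abs
        rw [abs_zero] at this
        exact this.eventually (gt_mem_nhds (by positivity))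
      have h2 : ∀ᶠ x in coclosedCompact E, |f x| < 1 / (n + 1) := by
        rwa [coclosedCompact_eq_cocompact]
      filter_upwards [h2] with x hx using hsmall x hx
    have hFd : ∀ x, HasLineDerivAt ℝ F (F' n x) x v := by
      intro x
      by_cases hx : x ∈ U
      · have h1 := hd x hx
        unfold HasLineDerivAt at h1 ⊢
        have h2 := (hasDerivAt_cutoff ((n + 1) * f x))
        have h3 := (HasDerivAt.comp_of_eq (0 : ℝ) h2 (h1.const_mul ((n : ℝ) + 1)) (by simp)).div_const
          ((n : ℝ) + 1)
        have h4 : F' n x = deriv cutoff ((n + 1) * f x) * ((n + 1) * f' x) / (n + 1) := by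
          rw [hF'eq, Set.indicator_of_mem hx]
          field_simp
        rw [h4]
        exact h3
      -- Outside `U` the function `f` is zero, hence by continuity small nearby, and the truncation
      -- vanishes on a whole neighbourhood. This replaces any regularity of the boundary.
      · have h0 : F' n x = 0 := by simp [F', hx]
        rw [h0]
        have h1 : ∀ᶠ y in 𝓝 x, F y = 0 := by
          have : ∀ᶠ y in 𝓝 x, |f y| < 1 / (n + 1) := by
            apply hf.abs.continuousAt.eventually (gt_mem_nhds _)
            simp only [hf0 x hx, abs_zero]; positivity
          filter_upwards [this] with y hy using hsmall y hy
        exact ((hasFDerivAt_const (0 : ℝ) x).hasLineDerivAt v).congr_of_eventuallyEq h1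
    have hFi : Integrable F μ := hFc.integrable_of_hasCompactSupport hcs
    -- Integration by parts against the constant `1`.
    have := integral_bilinear_hasLineDerivAt_right_eq_neg_left_of_integrable (μ := μ) (v := v)
      (f := fun _ => (1 : ℝ)) (f' := fun _ => 0) (g := F) (g' := F' n)
      (B := ContinuousLinearMap.mul ℝ ℝ) (by simp) (by simpa using hF'int n) (by simpa using hFi)
      (fun x _ => (hasFDerivAt_const (1 : ℝ) x).hasLineDerivAt v) (fun x _ => hFd x)
    simpa using this
  have hlim : Tendsto (fun n => ∫ x, F' n x ∂μ) atTop (𝓝 (∫ x, U.indicator f' x ∂μ)) := by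
    refine tendsto_integral_of_dominated_convergence _ hmeas (hi.norm.const_mul M)
      (fun n => ae_of_all _ (hbd n)) ?_
    -- Where `f ≠ 0` the cutoff factor is eventually `1`. Where `f = 0` it stays zero, but there the
    -- derivative itself is zero almost everywhere.
    filter_upwards [ae_lineDeriv_eq_zero_of_eq_zero μ hf v] with x hx
    by_cases hfx : f x = 0
    · have h0 : U.indicator f' x = 0 := by
        by_cases hxU : x ∈ U
        · rw [Set.indicator_of_mem hxU, ← (hd x hxU).lineDeriv, hx hfx]
        · simp [hxU]
      simp only [hF'eq, h0, mul_zero]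
      exact tendsto_const_nhds
    · refine tendsto_const_nhds.congr' ?_
      obtain ⟨N, hN⟩ := exists_nat_gt (2 / |f x|)
      filter_upwards [eventually_ge_atTop N] with n hn
      rw [hF'eq, deriv_cutoff_of_two_lt_abs, one_mul]
      have hpos := abs_pos.2 hfx
      have hn' : (N : ℝ) ≤ n := by exact_mod_cast hn
      rw [abs_mul, abs_of_pos (by positivity : (0:ℝ) < n + 1)]
      rw [div_lt_iff₀ hpos] at hN
      nlinarith
  simp only [hzero] at hlim
  rw [← integral_indicator hU.measurableSet]
  exact (tendsto_nhds_unique hlim tendsto_const_nhds)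

end LineDeriv

/-! ### Differentiability of feature maps from smoothness of the kernel. -/

/-- The second mixed difference of a `C²` function of two variables is close to the product of the
increments with the mixed derivative. -/
lemma exists_abs_mixed_difference_sub_le {g : ℝ × ℝ → ℝ} (hg : ContDiffAt ℝ 2 g (0, 0)) :
    ∃ L : ℝ, ∀ ε > 0, ∃ r > 0, ∀ t s : ℝ, |t| < r → |s| < r →
      |g (t, s) - g (t, 0) - g (0, s) + g (0, 0) - L * t * s| ≤ ε * |t| * |s| := by
  set g₁ : ℝ × ℝ → ℝ := fun z => fderiv ℝ g z (1, 0) with hg₁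
  set g₂ : ℝ × ℝ → ℝ := fun z => fderiv ℝ g₁ z (0, 1) with hg₂
  have hfd : ContDiffAt ℝ 1 (fderiv ℝ g) (0, 0) := hg.fderiv_right (by norm_num)
  have hc₁ : ContDiffAt ℝ 1 g₁ (0, 0) := hfd.clm_apply contDiffAt_const
  have hc₂ : ContDiffAt ℝ 0 g₂ (0, 0) :=
    (hc₁.fderiv_right (m := 0) (by norm_num)).clm_apply contDiffAt_const
  refine ⟨g₂ (0, 0), fun ε hε => ?_⟩
  have e1 : ∀ᶠ z in 𝓝 ((0 : ℝ), (0 : ℝ)), DifferentiableAt ℝ g z := by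
    filter_upwards [hg.eventually (by simp)] with z hz using hz.differentiableAt (by norm_num)
  have e2 : ∀ᶠ z in 𝓝 ((0 : ℝ), (0 : ℝ)), DifferentiableAt ℝ g₁ z := by
    filter_upwards [hc₁.eventually (by simp)] with z hz using hz.differentiableAt (by norm_num)
  have e3 : ∀ᶠ z in 𝓝 ((0 : ℝ), (0 : ℝ)), |g₂ z - g₂ (0, 0)| < ε :=
    Metric.continuousAt_iff'.1 hc₂.continuousAt ε hε
  obtain ⟨r, hr, hball⟩ := Metric.eventually_nhds_iff.1 (e1.and (e2.and e3))
  have hz : ∀ t s : ℝ, |t| < r → |s| < r → dist (t, s) ((0 : ℝ), (0 : ℝ)) < r := by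
    intro t s ht hs
    simpa [Prod.dist_eq] using ⟨ht, hs⟩
  refine ⟨r, hr, fun t s ht hs => ?_⟩
  have hd1 : ∀ τ σ : ℝ, |τ| < r → |σ| < r → HasDerivAt (fun τ => g (τ, σ)) (g₁ (τ, σ)) τ := by
    intro τ σ hτ hσ
    have h1 := (hball (hz τ σ hτ hσ)).1.hasFDerivAt
    exact h1.comp_hasDerivAt τ ((hasDerivAt_id τ).prodMk (hasDerivAt_const τ σ))
  have hd2 : ∀ τ σ : ℝ, |τ| < r → |σ| < r → HasDerivAt (fun σ => g₁ (τ, σ)) (g₂ (τ, σ)) σ := by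
    intro τ σ hτ hσ
    have h1 := (hball (hz τ σ hτ hσ)).2.1.hasFDerivAt
    exact h1.comp_hasDerivAt σ ((hasDerivAt_const σ τ).prodMk (hasDerivAt_id σ))
  have hconv : Convex ℝ (Metric.ball (0 : ℝ) r) := convex_ball 0 r
  have h0 : (0 : ℝ) ∈ Metric.ball (0 : ℝ) r := Metric.mem_ball_self hr
  have hmem : ∀ u : ℝ, u ∈ Metric.ball (0 : ℝ) r ↔ |u| < r := by simp
  have h0' : |(0 : ℝ)| < r := by simpa
  -- The mean value inequality is used twice: here in `s` for the first partial derivative, then in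
  -- `t` for the difference. Continuity of the mixed derivative at the origin alone supplies `ε`.
  have step1 : ∀ τ : ℝ, |τ| < r → |g₁ (τ, s) - g₁ (τ, 0) - g₂ (0, 0) * s| ≤ ε * |s| := by
    intro τ hτ
    have := hconv.norm_image_sub_le_of_norm_hasDerivWithin_le
      (f := fun σ => g₁ (τ, σ) - g₂ (0, 0) * σ) (f' := fun σ => g₂ (τ, σ) - g₂ (0, 0)) (C := ε)
      (fun σ hσ => by
        simpa using ((hd2 τ σ hτ ((hmem σ).1 hσ)).fun_sub
          ((hasDerivAt_id σ).const_mul (g₂ (0, 0)))).hasDerivWithinAt)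
      (fun σ hσ => (hball (hz τ σ hτ ((hmem σ).1 hσ))).2.2.le) h0 ((hmem s).2 hs)
    simp only [Real.norm_eq_abs, mul_zero, sub_zero] at this
    convert this using 2
    ring
  have step2 := hconv.norm_image_sub_le_of_norm_hasDerivWithin_le
    (f := fun τ => g (τ, s) - g (τ, 0) - g₂ (0, 0) * s * τ)
    (f' := fun τ => g₁ (τ, s) - g₁ (τ, 0) - g₂ (0, 0) * s) (C := ε * |s|)
    (fun τ hτ => by
      simpa using (((hd1 τ s ((hmem τ).1 hτ) hs).fun_sub (hd1 τ 0 ((hmem τ).1 hτ) h0')).fun_sub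
        ((hasDerivAt_id τ).const_mul (g₂ (0, 0) * s))).hasDerivWithinAt)
    (fun τ hτ => step1 τ ((hmem τ).1 hτ)) h0 ((hmem t).2 ht)
  simp only [Real.norm_eq_abs, mul_zero, sub_zero] at step2
  calc _ = _ := by congr 1; ring
    _ ≤ _ := step2
    _ = _ := by ring

variable {G : Type*} [NormedAddCommGroup G] [InnerProductSpace ℝ G] [CompleteSpace G]

/-- A curve in a Hilbert space whose Gram function is `C²` is differentiable. -/
lemma exists_hasDerivAt_zero_of_inner_contDiffAt {γ : ℝ → G} {g : ℝ × ℝ → ℝ}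
    (hg : ContDiffAt ℝ 2 g (0, 0))
    (hγ : ∃ r > 0, ∀ t s : ℝ, |t| < r → |s| < r → inner ℝ (γ t) (γ s) = g (t, s)) :
    ∃ w, HasDerivAt γ w 0 := by
  obtain ⟨L, hL⟩ := exists_abs_mixed_difference_sub_le hg
  obtain ⟨r₀, hr₀, hin⟩ := hγ
  have h0 : |(0 : ℝ)| < r₀ := by simpa
  set D : ℝ → G := fun t => t⁻¹ • (γ (0 + t) - γ 0)
  -- The Gram function of the difference quotients tends to `L` as `t` and `s` vanish independently,
  -- so `‖D t - D s‖²` tends to `L - 2L + L = 0`.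
  have hQ : ∀ ε > 0, ∃ r > 0, ∀ t s : ℝ, |t| < r → |s| < r → t ≠ 0 → s ≠ 0 →
      |inner ℝ (D t) (D s) - L| ≤ ε := by
    intro ε hε
    obtain ⟨r, hr, hb⟩ := hL ε hε
    refine ⟨min r r₀, lt_min hr hr₀, fun t s ht hs ht0 hs0 => ?_⟩
    have ht1 := ht.trans_le (min_le_left _ _)
    have ht2 := ht.trans_le (min_le_right _ _)
    have hs1 := hs.trans_le (min_le_left _ _)
    have hs2 := hs.trans_le (min_le_right _ _)
    have h1 := hb t s ht1 hs1
    have h2 : inner ℝ (D t) (D s) - L =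
        (g (t, s) - g (t, 0) - g (0, s) + g (0, 0) - L * t * s) / (t * s) := by
      simp only [D, zero_add, inner_smul_left, inner_smul_right, inner_sub_left, inner_sub_right,
        hin t s ht2 hs2, hin t 0 ht2 h0, hin 0 s h0 hs2, hin 0 0 h0 h0]
      simp only [conj_trivial]
      field_simp
      ring
    rw [h2, abs_div, abs_mul, div_le_iff₀ (by positivity)]
    linarith
  have hcauchy : Cauchy (map D (𝓝[≠] (0 : ℝ))) := by
    rw [Metric.cauchy_iff]
    refine ⟨inferInstance, fun ε hε => ?_⟩
    -- The expanded square contains four inner products, with total error at most `ε² / 2`.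
    obtain ⟨r, hr, hb⟩ := hQ (ε ^ 2 / 8) (by positivity)
    refine ⟨D '' {t | |t| < r ∧ t ≠ 0}, image_mem_map ?_, ?_⟩
    · refine mem_nhdsWithin.2 ⟨Metric.ball 0 r, Metric.isOpen_ball, Metric.mem_ball_self hr, ?_⟩
      rintro t ⟨ht, ht'⟩
      exact ⟨by simpa using ht, ht'⟩
    · rintro _ ⟨t, ⟨ht, ht0⟩, rfl⟩ _ ⟨s, ⟨hs, hs0⟩, rfl⟩
      rw [dist_eq_norm]
      have h1 := abs_le.1 (hb t t ht ht ht0 ht0)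
      have h2 := abs_le.1 (hb t s ht hs ht0 hs0)
      have h3 := abs_le.1 (hb s s hs hs hs0 hs0)
      have h4 := norm_sub_sq_real (D t) (D s)
      rw [real_inner_self_eq_norm_sq] at h1 h3
      have h5 : ‖D t - D s‖ ^ 2 < ε ^ 2 := by nlinarith
      exact lt_of_pow_lt_pow_left₀ 2 hε.le h5
  obtain ⟨w, hw⟩ := CompleteSpace.complete hcauchy
  exact ⟨w, hasDerivAt_iff_tendsto_slope_zero.2 hw⟩

/-- A feature map whose kernel is `C²` has line derivatives. -/
lemma exists_hasLineDerivAt_of_inner_contDiffOn {E : Type*} [NormedAddCommGroup E]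
    [NormedSpace ℝ E] {U : Set E} (hU : IsOpen U) {Φ : E → G} {k : E → E → ℝ}
    (hk : ContDiffOn ℝ 2 (fun z : E × E => k z.1 z.2) (U ×ˢ U))
    (hΦ : ∀ x ∈ U, ∀ y ∈ U, inner ℝ (Φ x) (Φ y) = k x y) {x : E} (hx : x ∈ U) (v : E) :
    ∃ w, HasLineDerivAt ℝ Φ w x v := by
  have hline : ContDiff ℝ 2 fun t : ℝ => x + t • v :=
    contDiff_const.add (contDiff_id.smul contDiff_const)
  have hx0 : x + (0 : ℝ) • v ∈ U := by simpa
  refine exists_hasDerivAt_zero_of_inner_contDiffAt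
    (g := fun z : ℝ × ℝ => k (x + z.1 • v) (x + z.2 • v)) ?_ ?_
  · have h1 : ContDiffAt ℝ 2 (fun z : E × E => k z.1 z.2) (x + (0 : ℝ) • v, x + (0 : ℝ) • v) :=
      hk.contDiffAt ((hU.prod hU).mem_nhds ⟨hx0, hx0⟩)
    exact h1.comp ((0 : ℝ), (0 : ℝ)) (f := fun z : ℝ × ℝ => (x + z.1 • v, x + z.2 • v))
      ((hline.comp contDiff_fst).prodMk (hline.comp contDiff_snd)).contDiffAt
  · have h1 : ∀ᶠ t in 𝓝 (0 : ℝ), x + t • v ∈ U :=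
      hline.continuous.continuousAt.eventually (hU.mem_nhds hx0)
    obtain ⟨r, hr, h⟩ := Metric.eventually_nhds_iff.1 h1
    exact ⟨r, hr, fun t s ht hs => hΦ _ (h (by simpa using ht)) _ (h (by simpa using hs))⟩

/-! ### Slices of the Hilbert space of a product kernel. -/

section ProductKernel

variable {X T V : Type*} [NormedAddCommGroup V] [InnerProductSpace ℝ V] [CompleteSpace V]
variable {H : Type*} [NormedAddCommGroup H] [InnerProductSpace ℝ H] [CompleteSpace H]
  [RKHS ℝ H (X × T) V]
variable {H₁ : Type*} [NormedAddCommGroup H₁] [InnerProductSpace ℝ H₁] [CompleteSpace H₁]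
  [RKHS ℝ H₁ X V]

variable (H H₁) in
/-- `H₁` has kernel `k₁ I` and `H` has kernel `k₁ k₂ I`. -/
structure IsProductKernel (k₁ : X → X → ℝ) (k₂ : T → T → ℝ) : Prop where
  fst : ∀ x x' : X, RKHS.kernel H₁ x x' = k₁ x x' • ContinuousLinearMap.id ℝ V
  prod : ∀ z z' : X × T, RKHS.kernel H z z' =
    (k₁ z.1 z'.1 * k₂ z.2 z'.2) • ContinuousLinearMap.id ℝ V

variable (H₁) in
/-- Linear combinations of kernel functions. -/
def kerSum : (X →₀ V) →ₗ[ℝ] H₁ := Finsupp.lsum ℝ fun x => (RKHS.kerFun H₁ x).toLinearMap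

variable (H) in
/-- Linear combinations of kernel functions with a fixed second argument. -/
def kerSumAt (β : T) : (X →₀ V) →ₗ[ℝ] H :=
  Finsupp.lsum ℝ fun x => (RKHS.kerFun H (x, β)).toLinearMap

lemma kerSum_single (x : X) (v : V) : kerSum H₁ (Finsupp.single x v) = RKHS.kerFun H₁ x v := by
  simp [kerSum]

lemma kerSumAt_single (β : T) (x : X) (v : V) :
    kerSumAt H β (Finsupp.single x v) = RKHS.kerFun H (x, β) v := by
  simp [kerSumAt]

lemma denseRange_kerSum : DenseRange (kerSum H₁ : (X →₀ V) → H₁) := by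
  have h := RKHS.kerFun_dense (𝕜 := ℝ) H₁
  have hle : Submodule.span ℝ {RKHS.kerFun H₁ x v | (x : X) (v : V)} ≤
      LinearMap.range (kerSum H₁ (X := X) (V := V)) := by
    rw [Submodule.span_le]
    rintro _ ⟨x, v, rfl⟩
    exact ⟨Finsupp.single x v, kerSum_single x v⟩
  have h2 := Submodule.topologicalClosure_mono hle
  rw [h, top_le_iff] at h2
  exact (Submodule.dense_iff_topologicalClosure_eq_top.2 h2)

variable (H H₁) in
/-- The map `H₁ → H` that sends the kernel function at `x` to the kernel function at `(x, β)`; its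
adjoint is the restriction `s ↦ s (·, β)`. -/
def sliceEmb (β : T) : H₁ →L[ℝ] H :=
  (kerSumAt H β : (X →₀ V) →ₗ[ℝ] H).extendOfNorm (kerSum H₁ : (X →₀ V) →ₗ[ℝ] H₁)

/-- The distance of the features of a scalar kernel. -/
def kernelDist {T : Type*} (k : T → T → ℝ) (β β' : T) : ℝ := √(k β β - k β β' - k β' β + k β' β')

lemma norm_le_sqrt_mul_of_sq_eq {E F : Type*} [NormedAddCommGroup E] [NormedAddCommGroup F]
    {a : E} {b : F} {c : ℝ} (h : ‖a‖ ^ 2 = c * ‖b‖ ^ 2) : ‖a‖ ≤ √c * ‖b‖ := by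
  rw [← Real.sqrt_sq (norm_nonneg a), h, Real.sqrt_mul' _ (sq_nonneg _),
    Real.sqrt_sq (norm_nonneg b)]

section ScalarKernel

variable {k₁ : X → X → ℝ}

lemma inner_kerFun_of_kernel_eq (hH₁ : ∀ x x' : X, RKHS.kernel H₁ x x' = k₁ x x' • ContinuousLinearMap.id ℝ V) (x y : X) (v w : V) :
    inner ℝ (RKHS.kerFun H₁ x v) (RKHS.kerFun H₁ y w) = k₁ x y * inner ℝ v w := by
  rw [RKHS.kerFun_inner, RKHS.kerFun_apply, hH₁]
  simp [inner_smul_right]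

lemma norm_kerFun_le (hH₁ : ∀ x x' : X, RKHS.kernel H₁ x x' = k₁ x x' • ContinuousLinearMap.id ℝ V) (x : X) :
    ‖RKHS.kerFun H₁ x‖ ≤ √(k₁ x x) := by
  refine ContinuousLinearMap.opNorm_le_bound _ (Real.sqrt_nonneg _) fun v => ?_
  refine norm_le_sqrt_mul_of_sq_eq ?_
  rw [← real_inner_self_eq_norm_sq, ← real_inner_self_eq_norm_sq, inner_kerFun_of_kernel_eq hH₁]

lemma norm_kerFun_sub_le (hH₁ : ∀ x x' : X, RKHS.kernel H₁ x x' = k₁ x x' • ContinuousLinearMap.id ℝ V) (x y : X) :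
    ‖RKHS.kerFun H₁ x - RKHS.kerFun H₁ y‖ ≤ kernelDist k₁ x y := by
  refine ContinuousLinearMap.opNorm_le_bound _ (Real.sqrt_nonneg _) fun v => ?_
  refine norm_le_sqrt_mul_of_sq_eq ?_
  rw [← real_inner_self_eq_norm_sq, ← real_inner_self_eq_norm_sq]
  simp only [_root_.sub_apply, inner_sub_left, inner_sub_right, inner_kerFun_of_kernel_eq hH₁]
  ring

lemma continuous_kerFun [TopologicalSpace X] (hH₁ : ∀ x x' : X, RKHS.kernel H₁ x x' = k₁ x x' • ContinuousLinearMap.id ℝ V)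
    (hk : Continuous fun z : X × X => k₁ z.1 z.2) :
    Continuous fun x => RKHS.kerFun H₁ x := by
  refine continuous_iff_continuousAt.2 fun x => ?_
  rw [ContinuousAt, tendsto_iff_norm_sub_tendsto_zero]
  have h : ∀ a b : X → X, Continuous a → Continuous b → Continuous fun y => k₁ (a y) (b y) :=
    fun a b ha hb => hk.comp (ha.prodMk hb)
  have hc : Continuous fun y => kernelDist k₁ y x := by
    refine Real.continuous_sqrt.comp (((( h _ _ continuous_id continuous_id).sub
      (h _ _ continuous_id continuous_const)).sub (h _ _ continuous_const continuous_id)).add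
      continuous_const)
  have hc0 : Tendsto (fun y => kernelDist k₁ y x) (𝓝 x) (𝓝 0) := by
    have := hc.tendsto x
    simpa [kernelDist] using this
  exact squeeze_zero (fun _ => norm_nonneg _) (fun y => norm_kerFun_sub_le hH₁ y x) hc0

end ScalarKernel

namespace IsProductKernel

variable {k₁ : X → X → ℝ} {k₂ : T → T → ℝ}

lemma inner_kerFun_prod (hK : IsProductKernel H H₁ k₁ k₂) (x y : X) (β β' : T) (v w : V) :
    inner ℝ (RKHS.kerFun H (x, β) v) (RKHS.kerFun H (y, β') w) =
      k₂ β β' * (k₁ x y * inner ℝ v w) := by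
  rw [RKHS.kerFun_inner, RKHS.kerFun_apply, hK.prod]
  simp [inner_smul_right]
  ring

/-- The kernel factorises, so on single kernel functions the two Gram functions differ by the factor
`k₂ β β'`, and bilinearity does the rest. With `β = β'` it gives the bound that makes `sliceEmb`
well defined. -/
lemma inner_kerSumAt (hK : IsProductKernel H H₁ k₁ k₂) (β β' : T) (f g : X →₀ V) :
    inner ℝ (kerSumAt H β f) (kerSumAt H β' g) = k₂ β β' * inner ℝ (kerSum H₁ f) (kerSum H₁ g) := by
  induction f using Finsupp.induction_linear with
  | zero => simp
  | add f₁ f₂ h1 h2 => simp only [map_add, inner_add_left, h1, h2, mul_add]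
  | single x v =>
    induction g using Finsupp.induction_linear with
    | zero => simp
    | add f₁ f₂ h1 h2 => simp only [map_add, inner_add_right, h1, h2, mul_add]
    | single y w =>
      rw [kerSumAt_single, kerSumAt_single, kerSum_single, kerSum_single, hK.inner_kerFun_prod,
        inner_kerFun_of_kernel_eq hK.fst]

lemma sliceEmb_kerSum (hK : IsProductKernel H H₁ k₁ k₂) (β : T) (f : X →₀ V) :
    sliceEmb H H₁ β (kerSum H₁ f) = kerSumAt H β f := by
  -- `extendOfNorm` agrees with the map on sums only in the presence of a norm bound. The constant
  -- `√(k₂ β β)` comes from the Gram identity.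
  refine LinearMap.extendOfNorm_eq denseRange_kerSum ⟨√(k₂ β β), fun g => ?_⟩ f
  refine norm_le_sqrt_mul_of_sq_eq ?_
  rw [← real_inner_self_eq_norm_sq, ← real_inner_self_eq_norm_sq, hK.inner_kerSumAt]

lemma sliceEmb_kerFun (hK : IsProductKernel H H₁ k₁ k₂) (β : T) (x : X) (v : V) :
    sliceEmb H H₁ β (RKHS.kerFun H₁ x v) = RKHS.kerFun H (x, β) v := by
  rw [← kerSum_single, hK.sliceEmb_kerSum, kerSumAt_single]

lemma inner_sliceEmb (hK : IsProductKernel H H₁ k₁ k₂) (β β' : T) (f g : H₁) :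
    inner ℝ (sliceEmb H H₁ β f) (sliceEmb H H₁ β' g) = k₂ β β' * inner ℝ f g := by
  refine (denseRange_kerSum (H₁ := H₁) (X := X)).induction_on₂ (p := fun f g =>
    inner ℝ (sliceEmb H H₁ β f) (sliceEmb H H₁ β' g) = k₂ β β' * inner ℝ f g) ?_ ?_ f g
  · exact isClosed_eq (by fun_prop) (by fun_prop)
  · intro a b
    rw [hK.sliceEmb_kerSum, hK.sliceEmb_kerSum, hK.inner_kerSumAt]

lemma adjoint_sliceEmb_apply (hK : IsProductKernel H H₁ k₁ k₂) (β : T) (s : H) (x : X) :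
    ((sliceEmb H H₁ β).adjoint s : H₁) x = s (x, β) := by
  refine ext_inner_left ℝ fun v => ?_
  rw [← RKHS.kerFun_inner, ContinuousLinearMap.adjoint_inner_right, hK.sliceEmb_kerFun,
    RKHS.kerFun_inner]

lemma norm_sliceEmb_le (hK : IsProductKernel H H₁ k₁ k₂) (β : T) :
    ‖sliceEmb H H₁ β‖ ≤ √(k₂ β β) := by
  refine ContinuousLinearMap.opNorm_le_bound _ (Real.sqrt_nonneg _) fun f => ?_
  refine norm_le_sqrt_mul_of_sq_eq ?_
  rw [← real_inner_self_eq_norm_sq, ← real_inner_self_eq_norm_sq, hK.inner_sliceEmb]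

/-- By the Gram identity the squared norm of the difference at `f` is `‖f‖²` times the expression
under the root in `kernelDist`. This is the only route by which estimation errors of latent vectors
enter. -/
lemma norm_sliceEmb_sub_le (hK : IsProductKernel H H₁ k₁ k₂) (β β' : T) :
    ‖sliceEmb H H₁ β - sliceEmb H H₁ β'‖ ≤ kernelDist k₂ β β' := by
  refine ContinuousLinearMap.opNorm_le_bound _ (Real.sqrt_nonneg _) fun f => ?_
  refine norm_le_sqrt_mul_of_sq_eq ?_
  rw [← real_inner_self_eq_norm_sq, ← real_inner_self_eq_norm_sq]
  simp only [_root_.sub_apply, inner_sub_left, inner_sub_right, hK.inner_sliceEmb]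
  ring

lemma kerFun_eq_comp (hK : IsProductKernel H H₁ k₁ k₂) (x : X) (β : T) :
    RKHS.kerFun H (x, β) = (sliceEmb H H₁ β).comp (RKHS.kerFun H₁ x) := by
  ext1 v
  exact (hK.sliceEmb_kerFun β x v).symm

end IsProductKernel

end ProductKernel

/-! ### The divergence as a bounded functional. -/

section Divergence

variable {d : ℕ} {S : Set (Euc d)} {k₁ : Euc d → Euc d → ℝ}
variable {H₁ : Type*} [NormedAddCommGroup H₁] [InnerProductSpace ℝ H₁] [CompleteSpace H₁]
  [RKHS ℝ H₁ S (Euc d)]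

variable (H₁) in
/-- The representer of the `j`-th coordinate of the evaluation at `x`, put to zero outside `S`. -/
def coordFeature (j : Fin d) : Euc d → H₁ :=
  Function.extend Subtype.val (fun x : S => RKHS.kerFun H₁ x (EuclideanSpace.single j 1)) 0

variable (H₁) in
/-- The representer of the divergence at `x`. -/
def divFeature (x : Euc d) : H₁ :=
  ∑ j, lineDeriv ℝ (coordFeature H₁ j) x (EuclideanSpace.single j 1)

lemma coordFeature_apply (j : Fin d) (x : S) :
    coordFeature H₁ j x = RKHS.kerFun H₁ x (EuclideanSpace.single j 1) :=
  Subtype.val_injective.extend_apply _ _ _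

lemma inner_coordFeature (j : Fin d) (h : H₁) (y : Euc d) :
    inner ℝ (coordFeature H₁ j y) h = Function.extend Subtype.val h 0 y j := by
  by_cases hy : y ∈ S
  · lift y to S using hy
    rw [coordFeature_apply, Subtype.val_injective.extend_apply, RKHS.kerFun_inner]
    simp [EuclideanSpace.inner_single_left]
  · have h0 : ¬ ∃ a : S, (a : Euc d) = y := fun ⟨a, ha⟩ => hy (ha ▸ a.2)
    simp [coordFeature, Function.extend_apply' _ _ _ h0]

lemma inner_coordFeature_coordFeature
    (hH₁ : ∀ x x' : S, RKHS.kernel H₁ x x' = k₁ x x' • ContinuousLinearMap.id ℝ (Euc d))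
    (j : Fin d) {x y : Euc d} (hx : x ∈ S) (hy : y ∈ S) :
    inner ℝ (coordFeature H₁ j x) (coordFeature H₁ j y) = k₁ x y := by
  lift x to S using hx
  lift y to S using hy
  rw [coordFeature_apply, coordFeature_apply, RKHS.kerFun_inner, RKHS.kerFun_apply, hH₁]
  simp [EuclideanSpace.inner_single_left]

/-- On `S` each coordinate feature has Gram function `k₁`, whose smoothness yields the derivative in
norm, not merely weakly. -/
lemma hasLineDerivAt_coordFeature
    (hH₁ : ∀ x x' : S, RKHS.kernel H₁ x x' = k₁ x x' • ContinuousLinearMap.id ℝ (Euc d))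
    (hk : ContDiffOn ℝ 2 (fun z : Euc d × Euc d => k₁ z.1 z.2) (S ×ˢ S)) (j : Fin d)
    {x : Euc d} (hx : x ∈ interior S) :
    HasLineDerivAt ℝ (coordFeature H₁ j)
      (lineDeriv ℝ (coordFeature H₁ j) x (EuclideanSpace.single j 1)) x
      (EuclideanSpace.single j 1) := by
  obtain ⟨w, hw⟩ := exists_hasLineDerivAt_of_inner_contDiffOn isOpen_interior
    (hk.mono (Set.prod_mono interior_subset interior_subset))
    (fun x hx y hy => inner_coordFeature_coordFeature (H₁ := H₁) hH₁ j (interior_subset hx)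
      (interior_subset hy)) hx (EuclideanSpace.single j 1)
  exact hw.lineDifferentiableAt.hasLineDerivAt

lemma hasLineDerivAt_coord
    (hH₁ : ∀ x x' : S, RKHS.kernel H₁ x x' = k₁ x x' • ContinuousLinearMap.id ℝ (Euc d))
    (hk : ContDiffOn ℝ 2 (fun z : Euc d × Euc d => k₁ z.1 z.2) (S ×ˢ S)) (j : Fin d) (h : H₁)
    {x : Euc d} (hx : x ∈ interior S) :
    HasLineDerivAt ℝ (fun y => Function.extend Subtype.val h 0 y j)
      (inner ℝ (lineDeriv ℝ (coordFeature H₁ j) x (EuclideanSpace.single j 1)) h) x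
      (EuclideanSpace.single j 1) := by
  have h1 := hasLineDerivAt_coordFeature hH₁ hk j hx
  unfold HasLineDerivAt at h1 ⊢
  have h2 := h1.inner ℝ (hasDerivAt_const (0 : ℝ) h)
  simpa [inner_coordFeature] using h2

lemma inner_divFeature
    (hH₁ : ∀ x x' : S, RKHS.kernel H₁ x x' = k₁ x x' • ContinuousLinearMap.id ℝ (Euc d))
    (hk : ContDiffOn ℝ 2 (fun z : Euc d × Euc d => k₁ z.1 z.2) (S ×ˢ S)) (h : H₁)
    {x : Euc d} (hx : x ∈ interior S) :
    inner ℝ (divFeature H₁ x) h = divergence h x := by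
  simp only [divFeature, sum_inner, divergence, partialDeriv]
  exact Finset.sum_congr rfl fun j _ => ((hasLineDerivAt_coord hH₁ hk j h hx).lineDeriv).symm

/-- Differentiating the Gram identity once in each variable. It converts the bound on the mixed
derivative of `k₁` into a bound on the representer. -/
lemma norm_lineDeriv_coordFeature_sq
    (hH₁ : ∀ x x' : S, RKHS.kernel H₁ x x' = k₁ x x' • ContinuousLinearMap.id ℝ (Euc d))
    (hk : ContDiffOn ℝ 2 (fun z : Euc d × Euc d => k₁ z.1 z.2) (S ×ˢ S)) (j : Fin d)
    {x : Euc d} (hx : x ∈ interior S) :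
    partialDeriv j (fun y => partialDeriv j (fun y' => k₁ y y') x) x =
      ‖lineDeriv ℝ (coordFeature H₁ j) x (EuclideanSpace.single j 1)‖ ^ 2 := by
  have h1 := hasLineDerivAt_coordFeature hH₁ hk j hx
  have hmem : ∀ᶠ y in 𝓝 x, y ∈ interior S := isOpen_interior.mem_nhds hx
  have h2 : ∀ y ∈ interior S, partialDeriv j (fun y' => k₁ y y') x =
      inner ℝ (coordFeature H₁ j y)
        (lineDeriv ℝ (coordFeature H₁ j) x (EuclideanSpace.single j 1)) := by
    intro y hy
    refine HasLineDerivAt.lineDeriv (HasLineDerivAt.congr_of_eventuallyEq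
      (f := fun y' => inner ℝ (coordFeature H₁ j y) (coordFeature H₁ j y')) ?_ ?_)
    · unfold HasLineDerivAt at h1 ⊢
      simpa using (hasDerivAt_const (0 : ℝ) (coordFeature H₁ j y)).inner ℝ h1
    · filter_upwards [hmem] with y' hy'
      exact (inner_coordFeature_coordFeature hH₁ j (interior_subset hy)
        (interior_subset hy')).symm
  refine HasLineDerivAt.lineDeriv (HasLineDerivAt.congr_of_eventuallyEq
    (f := fun y => inner ℝ (coordFeature H₁ j y)
      (lineDeriv ℝ (coordFeature H₁ j) x (EuclideanSpace.single j 1))) ?_ ?_)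
  · rw [← real_inner_self_eq_norm_sq]
    unfold HasLineDerivAt at h1 ⊢
    simpa using h1.inner ℝ (hasDerivAt_const (0 : ℝ)
      (lineDeriv ℝ (coordFeature H₁ j) x (EuclideanSpace.single j 1)))
  · filter_upwards [hmem] with y hy using h2 y hy

lemma norm_divFeature_le
    (hH₁ : ∀ x x' : S, RKHS.kernel H₁ x x' = k₁ x x' • ContinuousLinearMap.id ℝ (Euc d))
    (hk : ContDiffOn ℝ 2 (fun z : Euc d × Euc d => k₁ z.1 z.2) (S ×ˢ S)) {κ : ℝ}
    (hκ : ∀ j, ∀ x ∈ interior S, ∀ x' ∈ interior S,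
      partialDeriv j (fun y => partialDeriv j (fun y' => k₁ y y') x') x ≤ κ)
    {x : Euc d} (hx : x ∈ interior S) : ‖divFeature H₁ x‖ ≤ d * √κ := by
  refine (norm_sum_le _ _).trans ?_
  calc _ ≤ ∑ _j : Fin d, √κ := Finset.sum_le_sum fun j _ => by
        refine Real.le_sqrt_of_sq_le ?_
        rw [← norm_lineDeriv_coordFeature_sq hH₁ hk j hx]
        exact hκ j x hx x hx
    _ = d * √κ := by simp

lemma stronglyMeasurable_coordFeature (hS : MeasurableSet S)
    (hc : Continuous fun x : S => RKHS.kerFun H₁ x) (j : Fin d) :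
    StronglyMeasurable (coordFeature H₁ j) := by
  refine (MeasurableEmbedding.subtype_coe hS).stronglyMeasurable_extend ?_
    stronglyMeasurable_const
  exact (hc.clm_apply continuous_const).stronglyMeasurable

/-- A pointwise limit of difference quotients with steps `1 / (n + 1)`. The indicator is there
because convergence is known only in the interior. -/
lemma stronglyMeasurable_indicator_lineDeriv_coordFeature
    (hH₁ : ∀ x x' : S, RKHS.kernel H₁ x x' = k₁ x x' • ContinuousLinearMap.id ℝ (Euc d))
    (hk : ContDiffOn ℝ 2 (fun z : Euc d × Euc d => k₁ z.1 z.2) (S ×ˢ S)) (hS : MeasurableSet S)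
    (hc : Continuous fun x : S => RKHS.kerFun H₁ x) (j : Fin d) :
    StronglyMeasurable ((interior S).indicator fun x =>
      lineDeriv ℝ (coordFeature H₁ j) x (EuclideanSpace.single j 1)) := by
  have hm := stronglyMeasurable_coordFeature hS hc j
  set t : ℕ → ℝ := fun n => 1 / ((n : ℝ) + 1)
  have ht0 : Tendsto t atTop (𝓝[≠] 0) :=
    tendsto_nhdsWithin_iff.2 ⟨tendsto_one_div_add_atTop_nhds_zero_nat,
      Eventually.of_forall fun n => (Nat.one_div_pos_of_nat (α := ℝ)).ne'⟩
  refine stronglyMeasurable_of_tendsto atTop (f := fun (n : ℕ) => (interior S).indicator fun x =>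
    (t n)⁻¹ • (coordFeature H₁ j (x + t n • EuclideanSpace.single j 1) - coordFeature H₁ j x))
    (fun n => ?_) ?_
  · refine StronglyMeasurable.indicator ?_ isOpen_interior.measurableSet
    exact ((hm.comp_measurable (measurable_id.add_const _)).sub hm).const_smul _
  · rw [tendsto_pi_nhds]
    intro x
    by_cases hx : x ∈ interior S
    · simp only [Set.indicator_of_mem hx]
      exact (hasLineDerivAt_iff_tendsto_slope_zero.1
        (hasLineDerivAt_coordFeature hH₁ hk j hx)).comp ht0
    · simp only [Set.indicator_of_notMem hx]
      exact tendsto_const_nhds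

lemma stronglyMeasurable_indicator_divFeature
    (hH₁ : ∀ x x' : S, RKHS.kernel H₁ x x' = k₁ x x' • ContinuousLinearMap.id ℝ (Euc d))
    (hk : ContDiffOn ℝ 2 (fun z : Euc d × Euc d => k₁ z.1 z.2) (S ×ˢ S)) (hS : MeasurableSet S)
    (hc : Continuous fun x : S => RKHS.kerFun H₁ x) :
    StronglyMeasurable ((interior S).indicator (divFeature H₁)) := by
  have : (interior S).indicator (divFeature H₁) = fun x => ∑ j, (interior S).indicator (fun x =>
      lineDeriv ℝ (coordFeature H₁ j) x (EuclideanSpace.single j 1)) x := by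
    ext1 x
    by_cases hx : x ∈ interior S <;> simp [hx, divFeature]
  rw [this]
  exact Finset.stronglyMeasurable_fun_sum _ fun j _ =>
    stronglyMeasurable_indicator_lineDeriv_coordFeature hH₁ hk hS hc j

end Divergence

/-! ### Regularised linear equations with a positive operator. -/

section Resolvent

variable {G : Type*} [NormedAddCommGroup G] [InnerProductSpace ℝ G]

/-- Pair the equation with `z` and drop the nonnegative term. In other words, `lam (A + lam)⁻¹` is a
contraction for `lam > 0`. -/
lemma mul_norm_le_of_add_smul_eq {A : G →L[ℝ] G} (hA : ∀ z, 0 ≤ inner ℝ (A z) z) {lam : ℝ}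
    {z y : G} (h : A z + lam • z = y) : lam * ‖z‖ ≤ ‖y‖ := by
  have h1 : lam * ‖z‖ ^ 2 ≤ ‖y‖ * ‖z‖ := by
    calc lam * ‖z‖ ^ 2 ≤ inner ℝ (A z) z + lam * ‖z‖ ^ 2 := by linarith [hA z]
      _ = inner ℝ y z := by
        rw [← h, inner_add_left, inner_smul_left, real_inner_self_eq_norm_sq]
        simp
      _ ≤ ‖y‖ * ‖z‖ := real_inner_le_norm _ _
  rcases (norm_nonneg z).eq_or_lt with h0 | h0
  · rw [← h0]; simp
  · rw [pow_two, ← mul_assoc] at h1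
    exact le_of_mul_le_mul_right h1 h0

variable [CompleteSpace G]

/-- Lax–Milgram: the regularisation makes the form coercive with constant `lam`. -/
lemma exists_add_smul_eq {A : G →L[ℝ] G} (hA : ∀ z, 0 ≤ inner ℝ (A z) z) {lam : ℝ}
    (hlam : 0 < lam) (y : G) : ∃ z, A z + lam • z = y := by
  set B : G →L[ℝ] G →L[ℝ] ℝ := (innerSL ℝ).comp (A + lam • ContinuousLinearMap.id ℝ G)
  have hBv : ∀ v w, B v w = inner ℝ (A v + lam • v) w := fun v w => rfl
  have hB : IsCoercive B := by
    refine ⟨lam, hlam, fun u => ?_⟩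
    rw [hBv, inner_add_left, inner_smul_left, real_inner_self_eq_norm_sq]
    simp only [conj_trivial]
    nlinarith [hA u]
  obtain ⟨z, hz⟩ := hB.continuousLinearEquivOfBilin.surjective y
  refine ⟨z, ?_⟩
  rw [← hz]
  refine ext_inner_right ℝ fun w => ?_
  rw [hB.continuousLinearEquivOfBilin_apply, hBv]

/-- A regularised quadratic functional has exactly one minimiser, the solution of the normal
equation. -/
lemma exists_forall_isMin_iff {A : G →L[ℝ] G} (hA : ∀ z, 0 ≤ inner ℝ (A z) z)
    (hsymm : ∀ z w, inner ℝ (A z) w = inner ℝ z (A w)) {lam : ℝ} (hlam : 0 < lam) (ξ : G)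
    {J : G → ℝ} (hJ : ∀ t, J t = (1 / 2) * inner ℝ (A t) t + inner ℝ ξ t + lam / 2 * ‖t‖ ^ 2) :
    ∃ s, A s + lam • s = -ξ ∧ ∀ t, (∀ u, J t ≤ J u) ↔ t = s := by
  obtain ⟨s, hs⟩ := exists_add_smul_eq hA hlam (-ξ)
  -- Completing the square at the solution of the normal equation.
  have key : ∀ t, J t = J s + (1 / 2) * inner ℝ (A (t - s)) (t - s) + lam / 2 * ‖t - s‖ ^ 2 := by
    intro t
    have h1 : inner ℝ ξ (t - s) = - inner ℝ (A s) (t - s) - lam * inner ℝ s (t - s) := by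
      rw [← neg_neg ξ, ← hs, inner_neg_left, inner_add_left, inner_smul_left]
      simp only [conj_trivial]
      ring
    obtain ⟨u, rfl⟩ : ∃ u, t = s + u := ⟨t - s, by abel⟩
    rw [add_sub_cancel_left] at h1 ⊢
    rw [hJ, hJ, norm_add_sq_real, map_add]
    simp only [inner_add_left, inner_add_right, h1]
    rw [hsymm u s, real_inner_comm (A s) u]
    ring
  refine ⟨s, hs, fun t => ⟨fun h => ?_, ?_⟩⟩
  · have h1 := h s
    rw [key t] at h1
    have h2 := hA (t - s)
    have h3 : ‖t - s‖ ^ 2 ≤ 0 := by nlinarith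
    have h4 : ‖t - s‖ = 0 := pow_eq_zero_iff two_ne_zero |>.1 (le_antisymm h3 (sq_nonneg _))
    exact sub_eq_zero.1 (norm_eq_zero.1 h4)
  · rintro rfl u
    rw [key u]
    have := hA (u - t)
    nlinarith [sq_nonneg ‖u - t‖]

end Resolvent

/-! ### A weak law in Hilbert space. -/

section LawOfLargeNumbers

variable {Ω 𝓧 G : Type*} [MeasurableSpace Ω] [MeasurableSpace 𝓧] [NormedAddCommGroup G]
  [InnerProductSpace ℝ G] [CompleteSpace G] {P : Measure Ω} [IsProbabilityMeasure P]

/-- Chebyshev's inequality for the mean of independent bounded centred random elements of a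
Hilbert space. -/
lemma measure_norm_mean_ge_le {n : ℕ} {X : Fin n → Ω → 𝓧} (hX : ∀ i, Measurable (X i))
    (hind : iIndepFun X P) {f : Fin n → 𝓧 → G} (hf : ∀ i, AEStronglyMeasurable (f i) (P.map (X i)))
    {c : ℝ} (hc : 0 ≤ c) (hbd : ∀ i, ∀ᵐ x ∂(P.map (X i)), ‖f i x‖ ≤ c)
    (h0 : ∀ i, ∫ x, f i x ∂(P.map (X i)) = 0) {δ : ℝ} (hδ : 0 < δ) :
    P {ω | δ ≤ ‖(1 / (n : ℝ)) • ∑ i, f i (X i ω)‖} ≤ ENNReal.ofReal (c ^ 2 / (n * δ ^ 2)) := by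
  have hprob : ∀ i, IsProbabilityMeasure (P.map (X i)) := fun i =>
    Measure.isProbabilityMeasure_map (hX i).aemeasurable
  have hint : ∀ i, Integrable (f i) (P.map (X i)) := fun i =>
    Integrable.of_bound (hf i) c (hbd i)
  have hmeas : ∀ i, AEStronglyMeasurable (fun ω => f i (X i ω)) P := fun i =>
    (hf i).comp_measurable (hX i)
  have hbd' : ∀ i, ∀ᵐ ω ∂P, ‖f i (X i ω)‖ ≤ c := fun i =>
    ae_of_ae_map (hX i).aemeasurable (hbd i)
  have hint2 : ∀ i j, Integrable (fun ω => inner ℝ (f i (X i ω)) (f j (X j ω))) P := by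
    intro i j
    refine Integrable.of_bound ((hmeas i).inner (hmeas j)) (c * c) ?_
    filter_upwards [hbd' i, hbd' j] with ω h1 h2
    exact (norm_inner_le_norm _ _).trans (mul_le_mul h1 h2 (norm_nonneg _) hc)
  -- Independence and centring remove the off-diagonal terms, so the second moment of the sum is at
  -- most `n c²` instead of `n² c²`.
  have hcross : ∀ i j, i ≠ j → ∫ ω, inner ℝ (f i (X i ω)) (f j (X j ω)) ∂P = 0 := by
    intro i j hij
    have : ∫ ω, inner ℝ (f i (X i ω)) (f j (X j ω)) ∂P =
        inner ℝ (∫ ω, f i (X i ω) ∂P) (∫ ω, f j (X j ω) ∂P) := (hind.indepFun hij).integral_bilin_comp_comp (hX i).aemeasurable (hX j).aemeasurable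
      (hint i) (hint j) (innerSL ℝ)
    rw [this, ← integral_map (hX i).aemeasurable (hf i), h0 i, inner_zero_left]
  have hdiag : ∀ i, ∫ ω, inner ℝ (f i (X i ω)) (f i (X i ω)) ∂P ≤ c ^ 2 := by
    intro i
    calc _ ≤ ∫ _, c ^ 2 ∂P := by
          refine integral_mono_ae (hint2 i i) (integrable_const _) ?_
          filter_upwards [hbd' i] with ω h
          simp only [real_inner_self_eq_norm_sq]
          gcongr
      _ = c ^ 2 := by simp
  have hsum : ∀ ω, ‖∑ i, f i (X i ω)‖ ^ 2 =
      ∑ i, ∑ j, inner ℝ (f i (X i ω)) (f j (X j ω)) := by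
    intro ω
    rw [← real_inner_self_eq_norm_sq, sum_inner]
    simp only [inner_sum]
  have hsq : ∫ ω, ‖∑ i, f i (X i ω)‖ ^ 2 ∂P ≤ n * c ^ 2 := by
    simp only [hsum]
    rw [integral_finsetSum _ fun i _ => integrable_finsetSum _ fun j _ => hint2 i j]
    calc _ = ∑ i, ∫ ω, inner ℝ (f i (X i ω)) (f i (X i ω)) ∂P := by
          refine Finset.sum_congr rfl fun i _ => ?_
          rw [integral_finsetSum _ fun j _ => hint2 i j]
          exact Finset.sum_eq_single i (fun j _ hj => hcross i j hj.symm) (by simp)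
      _ ≤ ∑ _i : Fin n, c ^ 2 := Finset.sum_le_sum fun i _ => hdiag i
      _ = n * c ^ 2 := by simp
  -- For `n = 0` the mean is zero and the event is empty.
  rcases Nat.eq_zero_or_pos n with rfl | hn
  · simp [hδ.not_ge]
  have hn' : (0 : ℝ) < n := by exact_mod_cast hn
  have hI : Integrable (fun ω => ‖∑ i, f i (X i ω)‖ ^ 2) P := by
    simp only [hsum]
    exact integrable_finsetSum _ fun i _ => integrable_finsetSum _ fun j _ => hint2 i j
  have hcheb := mul_meas_ge_le_integral_of_nonneg (ae_of_all P fun ω => sq_nonneg _) hI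
    ((n * δ) ^ 2)
  have hset : {ω | δ ≤ ‖(1 / (n : ℝ)) • ∑ i, f i (X i ω)‖} =
      {ω | (n * δ) ^ 2 ≤ ‖∑ i, f i (X i ω)‖ ^ 2} := by
    ext ω
    simp only [Set.mem_ofPred_eq]
    rw [norm_smul, pow_le_pow_iff_left₀ (by positivity) (norm_nonneg _) two_ne_zero,
      Real.norm_of_nonneg (by positivity), one_div, inv_mul_eq_div, le_div_iff₀ hn', mul_comm]
  rw [hset, ← ofReal_measureReal]
  refine ENNReal.ofReal_le_ofReal ?_
  rw [le_div_iff₀ (by positivity)]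
  have h2 := hcheb.trans hsq
  have h3 : n * (P.real {ω | (n * δ) ^ 2 ≤ ‖∑ i, f i (X i ω)‖ ^ 2} * (n * δ ^ 2)) ≤
      n * c ^ 2 := by
    calc _ = _ := by ring
      _ ≤ _ := h2
  exact le_of_mul_le_mul_left h3 hn'

end LawOfLargeNumbers

/-! ### Choice of the regularisation rate. -/

/-- If `Y n = o_p(1)` then even `Y n = o_p(lam n)` for some deterministic `lam n → 0`, which can be
taken to decrease slowly. -/
lemma IsLittleOp.exists_rate {Ω : ℕ → Type*} [∀ n, MeasurableSpace (Ω n)]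
    {P : ∀ n, Measure (Ω n)} [∀ n, IsProbabilityMeasure (P n)] {Y : ∀ n, Ω n → ℝ≥0∞}
    (hY : IsLittleOp P Y) :
    ∃ lam : ℕ → ℝ, (∀ n, 0 < lam n) ∧ Tendsto lam atTop (𝓝 0) ∧
      (∀ n : ℕ, 1 / √((n : ℝ) + 1) ≤ lam n ^ 2) ∧
      ∀ η : ℝ, 0 < η →
        Tendsto (fun n => P n {ω | ENNReal.ofReal (η * lam n) ≤ Y n ω}) atTop (𝓝 0) := by
  -- The infimum of this set is the Ky Fan size of `Y n`, one number bounding both the level and the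
  -- probability of exceeding it.
  set A : ℕ → Set ℝ := fun n =>
    {ε | 0 ≤ ε ∧ P n {ω | ENNReal.ofReal ε ≤ Y n ω} ≤ ENNReal.ofReal ε}
  have hbdd : ∀ n, BddBelow (A n) := fun n => ⟨0, fun ε hε => hε.1⟩
  have hne : ∀ n, (A n).Nonempty := fun n => ⟨1, zero_le_one, by simpa using prob_le_one⟩
  set a : ℕ → ℝ := fun n => sInf (A n)
  have ha0 : ∀ n, 0 ≤ a n := fun n => le_csInf (hne n) fun ε hε => hε.1
  have ha : Tendsto a atTop (𝓝 0) := by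
    refine tendsto_order.2 ⟨fun b hb => Eventually.of_forall fun n => hb.trans_le (ha0 n),
      fun b hb => ?_⟩
    have hb2 : 0 < ENNReal.ofReal (b / 2) := by simpa using hb
    filter_upwards [(hY _ hb2).eventually (ge_mem_nhds hb2)] with n hn
    have : a n ≤ b / 2 := csInf_le (hbdd n) ⟨by positivity, hn⟩
    linarith
  -- The added term lifts `δ n` strictly above the infimum, which need not be attained, and prevents
  -- it from decaying too fast.
  set δ : ℕ → ℝ := fun n => a n + 1 / √((n : ℝ) + 1)
  have hpos : ∀ n : ℕ, 0 < 1 / √((n : ℝ) + 1) := fun n => by positivity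
  have hδ0 : ∀ n, 0 < δ n := fun n => add_pos_of_nonneg_of_pos (ha0 n) (hpos n)
  have hδ : Tendsto δ atTop (𝓝 0) := by
    have h1 : Tendsto (fun n : ℕ => 1 / √((n : ℝ) + 1)) atTop (𝓝 0) := by
      have := (Real.continuous_sqrt.tendsto 0).comp
        (tendsto_one_div_add_atTop_nhds_zero_nat (𝕜 := ℝ))
      simpa [Function.comp_def] using this
    simpa [δ] using ha.add h1
  have hP : ∀ n, P n {ω | ENNReal.ofReal (δ n) ≤ Y n ω} ≤ ENNReal.ofReal (δ n) := by
    intro n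
    obtain ⟨ε, hε, hlt⟩ := exists_lt_of_csInf_lt (hne n) (lt_add_of_pos_right (a n) (hpos n))
    have hle := ENNReal.ofReal_le_ofReal hlt.le
    exact (measure_mono fun ω hω => hle.trans hω).trans (hε.2.trans hle)
  -- The square root is of larger order than `δ n`: as soon as `√(δ n) ≤ η`, one has `δ n ≤ η √(δ
  -- n)`.
  refine ⟨fun n => √(δ n), fun n => Real.sqrt_pos.2 (hδ0 n), ?_, fun n => ?_, fun η hη => ?_⟩
  · have := (Real.continuous_sqrt.tendsto 0).comp hδ
    simpa [Function.comp_def] using this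
  · rw [Real.sq_sqrt (hδ0 n).le]
    exact le_add_of_nonneg_left (ha0 n)
  · have h0 : Tendsto (fun n => ENNReal.ofReal (δ n)) atTop (𝓝 0) := by
      simpa using ENNReal.tendsto_ofReal hδ
    refine tendsto_of_tendsto_of_tendsto_of_le_of_le' tendsto_const_nhds h0
      (Eventually.of_forall fun _ => zero_le) ?_
    filter_upwards [hδ.eventually (gt_mem_nhds (pow_pos hη 2))] with n hn
    refine (measure_mono fun ω hω => ?_).trans (hP n)
    refine le_trans (ENNReal.ofReal_le_ofReal ?_) hω
    have h1 : √(δ n) ≤ η := by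
      rw [Real.sqrt_le_left hη.le]; exact hn.le
    calc δ n = √(δ n) * √(δ n) := (Real.mul_self_sqrt (hδ0 n).le).symm
      _ ≤ η * √(δ n) := by gcongr

/-! ### Stein's identity. -/

section ScalarKernel

variable {d : ℕ} {S : Set (Euc d)} {k₁ : Euc d → Euc d → ℝ}
variable {H₁ : Type*} [NormedAddCommGroup H₁] [InnerProductSpace ℝ H₁] [CompleteSpace H₁]
  [RKHS ℝ H₁ S (Euc d)]

lemma continuous_coe_of_continuous_kerFun (hc : Continuous fun x : S => RKHS.kerFun H₁ x)
    (f : H₁) : Continuous (f : S → Euc d) := by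
  have h := (ContinuousLinearMap.adjoint (𝕜 := ℝ) (E := Euc d) (F := H₁)).continuous.comp hc
  simpa using h.clm_apply (continuous_const (y := f))

lemma continuousOn_extend_coe (hc : Continuous fun x : S => RKHS.kerFun H₁ x) (f : H₁) :
    ContinuousOn (Function.extend Subtype.val f 0) S := by
  rw [continuousOn_iff_continuous_domRestrict]
  convert continuous_coe_of_continuous_kerFun hc f using 1
  ext1 x
  exact Subtype.val_injective.extend_apply _ _ _

lemma norm_coe_le_mul_sqrt
    (hH₁ : ∀ x x' : S, RKHS.kernel H₁ x x' = k₁ x x' • ContinuousLinearMap.id ℝ (Euc d)) (f : H₁)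
    (x : S) : ‖f x‖ ≤ √(k₁ x x) * ‖f‖ := by
  rw [← RKHS.adjoint_kerFun]
  refine (ContinuousLinearMap.le_opNorm _ _).trans ?_
  rw [LinearIsometryEquiv.norm_map]
  exact mul_le_mul_of_nonneg_right (norm_kerFun_le (k₁ := fun x x' : S => k₁ x x') hH₁ x)
    (norm_nonneg _)

lemma norm_extend_coe_le
    (hH₁ : ∀ x x' : S, RKHS.kernel H₁ x x' = k₁ x x' • ContinuousLinearMap.id ℝ (Euc d)) (f : H₁)
    {x : Euc d} (hx : x ∈ S) : ‖Function.extend Subtype.val f 0 x‖ ≤ √(k₁ x x) * ‖f‖ := by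
  lift x to S using hx
  rw [Subtype.val_injective.extend_apply]
  exact norm_coe_le_mul_sqrt hH₁ f x

lemma abs_apply_le_norm (v : Euc d) (j : Fin d) : |v j| ≤ ‖v‖ := PiLp.norm_apply_le v j

/-- The partial derivatives of a positive differentiable function in terms of the gradient of its
logarithm. -/
lemma hasLineDerivAt_of_gradient_log {q : Euc d → ℝ} {x : Euc d} (hq : DifferentiableAt ℝ q x)
    (hpos : 0 < q x) (j : Fin d) :
    HasLineDerivAt ℝ q (q x * gradient (fun y => Real.log (q y)) x j) x
      (EuclideanSpace.single j 1) := by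
  have h1 := hq.hasFDerivAt.log hpos.ne'
  have h2 : gradient (fun y => Real.log (q y)) x j =
      (q x)⁻¹ * fderiv ℝ q x (EuclideanSpace.single j 1) := by
    have h3 : gradient (fun y => Real.log (q y)) x j =
        inner ℝ (gradient (fun y => Real.log (q y)) x) (EuclideanSpace.single j 1) := by
      rw [EuclideanSpace.inner_single_right]
      simp
    rw [h3, inner_gradient_left, h1.fderiv]
    simp
  rw [h2, mul_inv_cancel_left₀ hpos.ne']
  exact hq.hasFDerivAt.hasLineDerivAt _

/-- One coordinate of Stein's identity. -/
lemma setIntegral_stein_coord (hS : IsClosed S)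
    (hH₁ : ∀ x x' : S, RKHS.kernel H₁ x x' = k₁ x x' • ContinuousLinearMap.id ℝ (Euc d))
    (hk : ContDiffOn ℝ 2 (fun z : Euc d × Euc d => k₁ z.1 z.2) (S ×ˢ S))
    (hc : Continuous fun x : S => RKHS.kerFun H₁ x)
    {κ₁ κ₃ : ℝ} (hκ₁ : ∀ x ∈ S, k₁ x x ≤ κ₁)
    (hκ₃ : ∀ j, ∀ x ∈ interior S, ∀ x' ∈ interior S,
      partialDeriv j (fun y => partialDeriv j (fun y' => k₁ y y') x') x ≤ κ₃)
    {q : Euc d → ℝ} (hq : ContinuousOn q S) (hpos : ∀ x ∈ interior S, 0 < q x)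
    (hdiff : DifferentiableOn ℝ q (interior S)) (hqint : IntegrableOn q (interior S))
    (hdecay : Tendsto q (Bornology.cobounded (Euc d) ⊓ 𝓟 S) (𝓝 0))
    (hbdry : ∀ x ∈ frontier S, q x * k₁ x x = 0) {g : H₁}
    (hg : ∀ x : S, (x : Euc d) ∈ interior S → g x = gradient (fun y => Real.log (q y)) x)
    (f : H₁) (j : Fin d) :
    IntegrableOn (fun x => q x *
      (inner ℝ (lineDeriv ℝ (coordFeature H₁ j) x (EuclideanSpace.single j 1)) f +
        Function.extend Subtype.val g 0 x j * Function.extend Subtype.val f 0 x j)) (interior S) ∧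
    ∫ x in interior S, q x *
      (inner ℝ (lineDeriv ℝ (coordFeature H₁ j) x (EuclideanSpace.single j 1)) f +
        Function.extend Subtype.val g 0 x j * Function.extend Subtype.val f 0 x j) = 0 := by
  set e : Euc d := EuclideanSpace.single j 1
  set fj : Euc d → ℝ := fun x => Function.extend Subtype.val f 0 x j
  set gj : Euc d → ℝ := fun x => Function.extend Subtype.val g 0 x j
  have hcoord : ∀ h : H₁, ContinuousOn (fun x => Function.extend Subtype.val h 0 x j) S :=
    fun h => (continuous_apply j).comp_continuousOn
      ((PiLp.continuous_ofLp 2 _).comp_continuousOn (continuousOn_extend_coe hc h))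
  have hbound : ∀ (h : H₁), ∀ x ∈ S, |Function.extend Subtype.val h 0 x j| ≤ √κ₁ * ‖h‖ := by
    intro h x hx
    refine (abs_apply_le_norm _ j).trans ((norm_extend_coe_le hH₁ h hx).trans ?_)
    exact mul_le_mul_of_nonneg_right (Real.sqrt_le_sqrt (hκ₁ x hx)) (norm_nonneg _)
  have hintS : interior S ⊆ S := interior_subset
  have hmS : MeasurableSet (interior S) := isOpen_interior.measurableSet
  -- The extension by zero is continuous: at a frontier point either `q` vanishes, or `k₁ x x = 0`,
  -- and then every function of the space vanishes there.
  set F : Euc d → ℝ := S.indicator fun x => q x * fj x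
  set F' : Euc d → ℝ := fun x => q x *
    (inner ℝ (lineDeriv ℝ (coordFeature H₁ j) x e) f + gj x * fj x)
  have hFc : Continuous F := by
    refine continuous_indicator (fun x hx => ?_) (hS.closure_eq.symm ▸ hq.mul (hcoord f))
    have hxS : x ∈ S := hS.frontier_subset hx
    rcases mul_eq_zero.1 (hbdry x hx) with h | h
    · simp [h]
    · have h1 := (abs_apply_le_norm _ j).trans (norm_extend_coe_le hH₁ f hxS)
      rw [h, Real.sqrt_zero, zero_mul] at h1
      have h2 : fj x = 0 := abs_nonpos_iff.1 h1
      simp [h2]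
  have hF0 : ∀ x ∉ interior S, F x = 0 := by
    intro x hx
    by_cases hxS : x ∈ S
    · have hxf : x ∈ frontier S := by
        rw [hS.frontier_eq]; exact ⟨hxS, hx⟩
      refine (Set.indicator_of_mem hxS _).trans ?_
      rcases mul_eq_zero.1 (hbdry x hxf) with h | h
      · simp [h]
      · have h1 := (abs_apply_le_norm _ j).trans (norm_extend_coe_le hH₁ f hxS)
        rw [h, Real.sqrt_zero, zero_mul] at h1
        have h2 : fj x = 0 := abs_nonpos_iff.1 h1
        simp [h2]
    · exact Set.indicator_of_notMem hxS _
  have hFinf : Tendsto F (cocompact (Euc d)) (𝓝 0) := by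
    rw [← Metric.cobounded_eq_cocompact]
    have h1 : Tendsto (S.indicator q) (Bornology.cobounded (Euc d)) (𝓝 0) := by
      rw [Metric.tendsto_nhds] at hdecay ⊢
      intro ε hε
      filter_upwards [eventually_inf_principal.1 (hdecay ε hε)] with x hx
      by_cases hxS : x ∈ S
      · rw [Set.indicator_of_mem hxS]; exact hx hxS
      · rw [Set.indicator_of_notMem hxS]; simpa
    refine squeeze_zero_norm (a := fun x => ‖S.indicator q x‖ * (√κ₁ * ‖f‖)) (fun x => ?_) ?_
    · by_cases hxS : x ∈ S
      · simp only [F, Set.indicator_of_mem hxS, norm_mul]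
        exact mul_le_mul_of_nonneg_left (hbound f x hxS) (norm_nonneg _)
      · simp [F, Set.indicator_of_notMem hxS]
    · simpa using h1.norm.mul_const (√κ₁ * ‖f‖)
  have hd : ∀ x ∈ interior S, HasLineDerivAt ℝ F (F' x) x e := by
    intro x hx
    have h1 := hasLineDerivAt_coord hH₁ hk j f hx
    have h2 := hasLineDerivAt_of_gradient_log
      (hdiff.differentiableAt (isOpen_interior.mem_nhds hx)) (hpos x hx) j
    have h3 : gradient (fun y => Real.log (q y)) x j = gj x := by
      have := hg ⟨x, hintS hx⟩ hx
      rw [← this, ← Subtype.val_injective.extend_apply g 0 ⟨x, hintS hx⟩]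
    rw [h3] at h2
    have h4 : HasLineDerivAt ℝ (fun x => q x * fj x) (F' x) x e := by
      unfold HasLineDerivAt at h1 h2 ⊢
      have h5 := h2.mul h1
      simp only [zero_smul, add_zero] at h5
      have h6 : F' x = q x * gj x * fj x +
          q x * inner ℝ (lineDeriv ℝ (coordFeature H₁ j) x e) f := by
        simp only [F']
        ring
      rw [h6]
      exact h5
    refine h4.congr_of_eventuallyEq ?_
    filter_upwards [isOpen_interior.mem_nhds hx] with y hy
    exact Set.indicator_of_mem (hintS hy) _
  -- The score enters through `g`, an element of the space and so bounded. The derivative is thus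
  -- the integrable `q` times a bounded factor.
  have hint : IntegrableOn F' (interior S) := by
    refine Integrable.mul_bdd (c := √κ₃ * ‖f‖ + (√κ₁ * ‖g‖) * (√κ₁ * ‖f‖)) hqint ?_ ?_
    · refine AEStronglyMeasurable.add ?_ (AEStronglyMeasurable.mul ?_ ?_)
      · have h1 := stronglyMeasurable_indicator_lineDeriv_coordFeature hH₁ hk hS.measurableSet hc j
        have h2 := (h1.inner (stronglyMeasurable_const (b := f)) (𝕜 := ℝ)).aestronglyMeasurable
          (μ := (volume : Measure (Euc d)).restrict (interior S))
        refine h2.congr ?_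
        filter_upwards [ae_restrict_mem hmS] with x hx
        rw [Set.indicator_of_mem hx]
      · exact ((hcoord g).mono hintS).aestronglyMeasurable hmS
      · exact ((hcoord f).mono hintS).aestronglyMeasurable hmS
    · filter_upwards [ae_restrict_mem hmS] with x hx
      refine (norm_add_le _ _).trans (add_le_add ?_ ?_)
      · refine (norm_inner_le_norm _ _).trans (mul_le_mul_of_nonneg_right ?_ (norm_nonneg _))
        refine Real.le_sqrt_of_sq_le ?_
        rw [← norm_lineDeriv_coordFeature_sq hH₁ hk j hx]
        exact hκ₃ j x hx x hx
      · rw [norm_mul]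
        exact mul_le_mul (hbound g x (hintS hx)) (hbound f x (hintS hx)) (norm_nonneg _)
          (by positivity)
  exact ⟨hint, setIntegral_lineDeriv_eq_zero volume isOpen_interior hFc hF0 hFinf hd hint⟩

/-- Stein's identity. -/
lemma setIntegral_stein (hS : IsClosed S)
    (hH₁ : ∀ x x' : S, RKHS.kernel H₁ x x' = k₁ x x' • ContinuousLinearMap.id ℝ (Euc d))
    (hk : ContDiffOn ℝ 2 (fun z : Euc d × Euc d => k₁ z.1 z.2) (S ×ˢ S))
    (hc : Continuous fun x : S => RKHS.kerFun H₁ x)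
    {κ₁ κ₃ : ℝ} (hκ₁ : ∀ x ∈ S, k₁ x x ≤ κ₁)
    (hκ₃ : ∀ j, ∀ x ∈ interior S, ∀ x' ∈ interior S,
      partialDeriv j (fun y => partialDeriv j (fun y' => k₁ y y') x') x ≤ κ₃)
    {q : Euc d → ℝ} (hq : ContinuousOn q S) (hpos : ∀ x ∈ interior S, 0 < q x)
    (hdiff : DifferentiableOn ℝ q (interior S)) (hqint : IntegrableOn q (interior S))
    (hdecay : Tendsto q (Bornology.cobounded (Euc d) ⊓ 𝓟 S) (𝓝 0))
    (hbdry : ∀ x ∈ frontier S, q x * k₁ x x = 0) {g : H₁}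
    (hg : ∀ x : S, (x : Euc d) ∈ interior S → g x = gradient (fun y => Real.log (q y)) x)
    (f : H₁) :
    ∫ x in interior S, q x * (inner ℝ (divFeature H₁ x) f +
        inner ℝ (Function.extend Subtype.val g 0 x) (Function.extend Subtype.val f 0 x)) = 0 := by
  have h := setIntegral_stein_coord hS hH₁ hk hc hκ₁ hκ₃ hq hpos hdiff hqint hdecay hbdry hg f
  have heq : ∀ x, q x * (inner ℝ (divFeature H₁ x) f +
      inner ℝ (Function.extend Subtype.val g 0 x) (Function.extend Subtype.val f 0 x)) =
      ∑ j, q x * (inner ℝ (lineDeriv ℝ (coordFeature H₁ j) x (EuclideanSpace.single j 1)) f +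
        Function.extend Subtype.val g 0 x j * Function.extend Subtype.val f 0 x j) := by
    intro x
    rw [divFeature, sum_inner, PiLp.inner_apply, ← Finset.sum_add_distrib, Finset.mul_sum]
    simp [mul_comm]
  simp only [heq]
  rw [integral_finsetSum _ fun j _ => (h j).1]
  exact Finset.sum_eq_zero fun j _ => (h j).2

end ScalarKernel

/-! ### Integration against the densities. -/

section Density

variable {d m : ℕ} {S : Set (Euc d)} {T : Set (Euc m)} {k₁ : Euc d → Euc d → ℝ}
  {p : Euc d → Euc m → ℝ}

lemma densityMeasure_absolutelyContinuous (S : Set (Euc d)) (p : Euc d → Euc m → ℝ) (β : Euc m) :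
    densityMeasure S p β ≪ (volume : Measure (Euc d)).comap (Subtype.val : S → Euc d) :=
  withDensity_absolutelyContinuous _ _

lemma ae_densityMeasure_mem_interior {p : Euc d → Euc m → ℝ} (hS : IsClosed S) (hnull : (volume : Measure (Euc d)) (frontier S) = 0)
    (β : Euc m) : ∀ᵐ x : S ∂(densityMeasure S p β), (x : Euc d) ∈ interior S := by
  refine (densityMeasure_absolutelyContinuous S p β).ae_le ?_
  have h1 : ∀ᵐ x ∂(volume : Measure (Euc d)), x ∉ frontier S := by
    rw [ae_iff]; simpa using hnull
  have h2 := (ae_restrict_iff_subtype (μ := (volume : Measure (Euc d))) hS.measurableSet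
    (p := fun x => x ∉ frontier S)).1 (ae_restrict_of_ae h1)
  filter_upwards [h2] with x hx
  by_contra h
  exact hx (by rw [hS.frontier_eq]; exact ⟨x.2, h⟩)

/-- Positivity is given in the interior only; it passes to the boundary as a weak inequality because
`S` is the closure of its interior. -/
lemma DensityRegularity.nonneg (hp : DensityRegularity S T k₁ p) (hS : closure (interior S) = S)
    {β : Euc m} (hβ : β ∈ T) {x : Euc d} (hx : x ∈ S) : 0 ≤ p x β := by
  have h1 : closure (interior S) ⊆ S := hS.le
  have hcl : IsClosed S := hS ▸ isClosed_closure
  have h2 := (hp.continuousOn β hβ).preimage_isClosed_of_isClosed hcl (isClosed_Ici (a := (0:ℝ)))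
  have h3 : closure (interior S) ⊆ S ∩ (fun x => p x β) ⁻¹' Set.Ici 0 :=
    closure_minimal (fun y hy => ⟨interior_subset hy, (hp.pos β hβ y hy).le⟩) h2
  exact (h3 (hS.symm ▸ hx)).2

lemma DensityRegularity.measurable (hp : DensityRegularity S T k₁ p) {β : Euc m} (hβ : β ∈ T) :
    Measurable fun x : S => p x β :=
  (continuousOn_iff_continuous_domRestrict.1 (hp.continuousOn β hβ)).measurable

lemma restrict_interior_eq (hS : IsClosed S) (hnull : volume (frontier S) = 0) :
    (volume : Measure (Euc d)).restrict (interior S) = volume.restrict S := by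
  refine Measure.restrict_congr_set ?_
  refine (ae_eq_set.2 ⟨?_, ?_⟩)
  · rw [Set.sdiff_eq_empty.2 interior_subset]; simp
  · rw [← hS.frontier_eq]; exact hnull

/-- Integrals with respect to the density. -/
lemma DensityRegularity.integral_eq (hp : DensityRegularity S T k₁ p)
    (hS : closure (interior S) = S) (hnull : volume (frontier S) = 0) {β : Euc m} (hβ : β ∈ T)
    (F : Euc d → ℝ) :
    ∫ x : S, F x ∂(densityMeasure S p β) = ∫ x in interior S, p x β * F x := by
  have hcl : IsClosed S := hS ▸ isClosed_closure
  rw [densityMeasure, integral_withDensity_eq_integral_toReal_smul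
    (hp.measurable hβ).ennreal_ofReal (ae_of_all _ fun _ => ENNReal.ofReal_lt_top),
    restrict_interior_eq hcl hnull, ← integral_subtype_comap hcl.measurableSet]
  refine integral_congr_ae (ae_of_all _ fun x => ?_)
  simp [ENNReal.toReal_ofReal (hp.nonneg hS hβ x.2)]

lemma DensityRegularity.integrableOn (hp : DensityRegularity S T k₁ p)
    (hS : closure (interior S) = S) (hnull : volume (frontier S) = 0) {β : Euc m} (hβ : β ∈ T) :
    IntegrableOn (fun x => p x β) (interior S) := by
  have hcl : IsClosed S := hS ▸ isClosed_closure
  have hprob := hp.isProb β hβ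
  rw [IntegrableOn, restrict_interior_eq hcl hnull, ← IntegrableOn,
    integrableOn_iff_comap_subtypeVal hcl.measurableSet]
  refine ⟨(hp.measurable hβ).aestronglyMeasurable, ?_⟩
  refine (hasFiniteIntegral_iff_ofReal (ae_of_all _ fun x : S => hp.nonneg hS hβ x.2)).2 ?_
  have h1 := measure_lt_top (densityMeasure S p β) Set.univ
  rw [densityMeasure, withDensity_apply _ MeasurableSet.univ, Measure.restrict_univ] at h1
  exact h1

end Density

/-! ### Convergence of the regularisation bias. -/

section RangeProj

variable {G : Type*} [NormedAddCommGroup G] [InnerProductSpace ℝ G] [CompleteSpace G]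

lemma norm_rangeProj_apply_le (A : G →L[ℝ] G) (v : G) : ‖rangeProj A v‖ ≤ ‖v‖ :=
  Submodule.norm_starProjection_apply_le _ _

lemma rangeProj_apply_self (A : G →L[ℝ] G) (v : G) : rangeProj A (A v) = A v :=
  Submodule.starProjection_eq_self_iff.2
    (Submodule.le_topologicalClosure _ (LinearMap.mem_range_self A.toLinearMap v))

/-- A symmetric operator vanishes on the orthogonal complement of its range. -/
lemma apply_rangeProj {A : G →L[ℝ] G} (hsymm : ∀ z w, inner ℝ (A z) w = inner ℝ z (A w)) (v : G) :
    A (rangeProj A v) = A v := by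
  have h1 : ∀ w, inner ℝ (v - rangeProj A v) (A w) = 0 := fun w =>
    Submodule.starProjection_inner_eq_zero v (A w)
      (Submodule.le_topologicalClosure _ (LinearMap.mem_range_self A.toLinearMap w))
  have h2 : A (v - rangeProj A v) = 0 := by
    refine ext_inner_right ℝ fun w => ?_
    rw [hsymm, h1, inner_zero_left]
  rw [map_sub, sub_eq_zero] at h2
  exact h2.symm

lemma exists_norm_rangeProj_sub_lt (A : G →L[ℝ] G) (v : G) {ε : ℝ} (hε : 0 < ε) :
    ∃ w, ‖rangeProj A v - A w‖ < ε := by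
  have h : rangeProj A v ∈ closure (Set.range A) := by
    have : rangeProj A v ∈ (LinearMap.range A.toLinearMap).topologicalClosure :=
      Submodule.starProjection_apply_mem _ _
    rw [← SetLike.mem_coe, Submodule.topologicalClosure_coe, LinearMap.coe_range] at this
    exact this
  obtain ⟨_, ⟨w, rfl⟩, hw⟩ := Metric.mem_closure_iff.1 h ε hε
  exact ⟨w, by rwa [← dist_eq_norm]⟩

/-- The regularised solutions of `A n z = A n v` approach the projections of `v` if `A n` converges
and the limit projection dominates asymptotically. -/
lemma tendsto_norm_regularised_sub_rangeProj {A : ℕ → G →L[ℝ] G} {C : G →L[ℝ] G}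
    (hpos : ∀ n z, 0 ≤ inner ℝ (A n z) z)
    (hsymm : ∀ n z w, inner ℝ (A n z) w = inner ℝ z (A n w))
    (hA : Tendsto A atTop (𝓝 C)) {v : G}
    (hproj : Tendsto (fun n => rangeProj (A n) (v - rangeProj C v)) atTop (𝓝 0))
    {lam : ℕ → ℝ} (hlam : ∀ n, 0 < lam n) (hlam0 : Tendsto lam atTop (𝓝 0)) {s : ℕ → G}
    (hs : ∀ n, A n (s n) + lam n • s n = A n v) :
    Tendsto (fun n => ‖s n - rangeProj (A n) v‖) atTop (𝓝 0) := by
  -- With `u` the projection of `v`, `u - s n = lam (A n + lam)⁻¹ u`. This is small on vectors `A n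
  -- w` and never expands the rest, so `u` is approximated by `A n w` with `w` free of `n`.
  have key : ∀ n w, ‖s n - rangeProj (A n) v‖ ≤ 2 * lam n * ‖w‖ + ‖A n - C‖ * ‖w‖ +
      ‖rangeProj C v - C w‖ + ‖rangeProj (A n) (v - rangeProj C v)‖ := by
    intro n w
    -- Here `y = lam (A n + lam)⁻¹ w`, and `lam (A n + lam)⁻¹ A n w = lam (w - y)` has norm at most
    -- `2 lam ‖w‖`.
    obtain ⟨y, hy⟩ := exists_add_smul_eq (hpos n) (hlam n) (lam n • w)
    have hyn : ‖y‖ ≤ ‖w‖ := by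
      have := mul_norm_le_of_add_smul_eq (hpos n) hy
      rw [norm_smul, Real.norm_of_nonneg (hlam n).le] at this
      exact le_of_mul_le_mul_left this (hlam n)
    set u := rangeProj (A n) v
    set z := u - s n
    set z' := lam n • (w - y)
    -- The remainder `u - A n w` in three pieces: operator convergence, approximation of the limit
    -- projection by the range of `C`, and the part of `v` invisible to `C`.
    set R := rangeProj (A n) (C w - A n w) + rangeProj (A n) (rangeProj C v - C w) +
      rangeProj (A n) (v - rangeProj C v) with hR
    have hu : u = A n w + R := by
      rw [hR, ← map_add, ← map_add]
      have : C w - A n w + (rangeProj C v - C w) + (v - rangeProj C v) = v - A n w := by abel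
      rw [this, map_sub, rangeProj_apply_self]
      abel
    have hz : A n z + lam n • z = lam n • u := by
      simp only [z, map_sub, smul_sub]
      rw [apply_rangeProj (hsymm n), ← hs n]
      abel
    have hz' : A n z' + lam n • z' = lam n • A n w := by
      simp only [z', map_smul, map_sub, ← smul_add]
      congr 1
      have : A n w - A n y + lam n • (w - y) = A n w + lam n • w - (A n y + lam n • y) := by
        rw [smul_sub]; abel
      rw [this, hy]
      abel
    have hzz : A n (z - z') + lam n • (z - z') = lam n • R := by
      have : A n (z - z') + lam n • (z - z') = (A n z + lam n • z) - (A n z' + lam n • z') := by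
        rw [map_sub, smul_sub]; abel
      rw [this, hz, hz', hu, smul_add]
      abel
    have h1 : ‖z - z'‖ ≤ ‖R‖ := by
      have := mul_norm_le_of_add_smul_eq (hpos n) hzz
      rw [norm_smul, Real.norm_of_nonneg (hlam n).le] at this
      exact le_of_mul_le_mul_left this (hlam n)
    have h2 : ‖z'‖ ≤ 2 * lam n * ‖w‖ := by
      rw [norm_smul, Real.norm_of_nonneg (hlam n).le]
      have := norm_sub_le w y
      nlinarith [hlam n]
    have h3 : ‖R‖ ≤ ‖A n - C‖ * ‖w‖ + ‖rangeProj C v - C w‖ +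
        ‖rangeProj (A n) (v - rangeProj C v)‖ := by
      refine (norm_add₃_le).trans ?_
      gcongr
      · refine (norm_rangeProj_apply_le _ _).trans ?_
        rw [norm_sub_rev, ← _root_.sub_apply]
        exact (A n - C).le_opNorm w
      · exact norm_rangeProj_apply_le _ _
    have h4 : ‖z‖ ≤ ‖z - z'‖ + ‖z'‖ := by
      simpa using norm_add_le (z - z') z'
    rw [norm_sub_rev]
    linarith
  refine tendsto_order.2 ⟨fun b hb => Eventually.of_forall fun n => hb.trans_le (norm_nonneg _),
    fun b hb => ?_⟩
  -- Fixing `w` before `n` grows leaves only its approximation error, below `b / 2`, in the limit.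
  obtain ⟨w, hw⟩ := exists_norm_rangeProj_sub_lt C v (half_pos hb)
  have h1 : Tendsto (fun n => ‖A n - C‖) atTop (𝓝 0) := tendsto_iff_norm_sub_tendsto_zero.1 hA
  have h2 : Tendsto (fun n => 2 * lam n * ‖w‖ + ‖A n - C‖ * ‖w‖ + ‖rangeProj C v - C w‖ +
      ‖rangeProj (A n) (v - rangeProj C v)‖) atTop (𝓝 (‖rangeProj C v - C w‖)) := by
    have := ((((hlam0.const_mul 2).mul_const ‖w‖).add (h1.mul_const ‖w‖)).add
      (tendsto_const_nhds (x := ‖rangeProj C v - C w‖))).add hproj.norm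
    simpa using this
  filter_upwards [h2.eventually (gt_mem_nhds (hw.trans (half_lt_self hb)))] with n hn
  exact (key n w).trans_lt hn

end RangeProj

/-! ### Score terms and the population covariance operator. -/

section Setting

variable {d m : ℕ} {S : Set (Euc d)} {T : Set (Euc m)} {k₁ : Euc d → Euc d → ℝ}
  {k₂ : Euc m → Euc m → ℝ} {p : Euc d → Euc m → ℝ}
variable {H : Type*} [NormedAddCommGroup H] [InnerProductSpace ℝ H] [CompleteSpace H]
  [RKHS ℝ H (S × T) (Euc d)]
variable {H₁ : Type*} [NormedAddCommGroup H₁] [InnerProductSpace ℝ H₁] [CompleteSpace H₁]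
  [RKHS ℝ H₁ S (Euc d)]

variable (H H₁) in
/-- A pair of reproducing kernel Hilbert spaces with smooth bounded kernels `k₁ k₂ I` and `k₁ I`. -/
structure BoundedKernels (k₁ : Euc d → Euc d → ℝ) (k₂ : Euc m → Euc m → ℝ) (a r D : ℝ) : Prop where
  isProductKernel : IsProductKernel H H₁ (fun x x' : S => k₁ x x') (fun β β' : T => k₂ β β')
  contDiffOn : ContDiffOn ℝ 2 (fun z : Euc d × Euc d => k₁ z.1 z.2) (S ×ˢ S)
  continuous_kerFun : Continuous fun x : S => RKHS.kerFun H₁ x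
  norm_sliceEmb : ∀ β : T, ‖sliceEmb H H₁ β‖ ≤ a
  norm_kerFun : ∀ x : S, ‖RKHS.kerFun H₁ x‖ ≤ r
  norm_divFeature : ∀ x ∈ interior S, ‖divFeature H₁ x‖ ≤ D
  nonneg_slice : 0 ≤ a
  nonneg_ker : 0 ≤ r
  nonneg_div : 0 ≤ D

lemma KernelRegularity.exists_boundedKernels (hT : IsCompact T) (hk : KernelRegularity S T k₁ k₂)
    (hK : IsProductKernel H H₁ (fun x x' : S => k₁ x x') (fun β β' : T => k₂ β β')) :
    ∃ a r D : ℝ, BoundedKernels H H₁ k₁ k₂ a r D := by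
  obtain ⟨κ₁, hκ₁⟩ := hk.bdd_fst
  obtain ⟨κ₃, hκ₃⟩ := hk.bdd_deriv_fst
  have hc2 : ContinuousOn (fun β => k₂ β β) T :=
    hk.contDiffOn_snd.continuousOn.comp (continuousOn_id.prodMk continuousOn_id)
      fun β hβ => ⟨hβ, hβ⟩
  obtain ⟨κ₂, hκ₂⟩ := hT.exists_bound_of_continuousOn hc2
  have hc1 : Continuous fun z : S × S => k₁ z.1 z.2 :=
    hk.contDiffOn_fst.continuousOn.comp_continuous (f := fun z : S × S => ((z.1 : Euc d), (z.2 : Euc d)))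
      (by fun_prop) fun z => ⟨z.1.2, z.2.2⟩
  refine ⟨√κ₂, √κ₁, d * √κ₃, hK, hk.contDiffOn_fst, continuous_kerFun hK.fst hc1, fun β => ?_,
    fun x => ?_, fun x hx => norm_divFeature_le hK.fst hk.contDiffOn_fst hκ₃ hx, by positivity,
    by positivity, by positivity⟩
  · refine (hK.norm_sliceEmb_le β).trans (Real.sqrt_le_sqrt ?_)
    exact (le_abs_self _).trans (hκ₂ β β.2)
  · exact (norm_kerFun_le hK.fst x).trans (Real.sqrt_le_sqrt (hκ₁ x x.2))

variable (H₁) in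
/-- The gradient at `s` of `s ↦ ½ ‖s (x, β)‖² + ∇ · s (x, β)`. -/
def scoreTerm (s : H) (β : T) (x : S) : H :=
  sliceEmb H H₁ β (divFeature H₁ (x : Euc d) + RKHS.kerFun H₁ x (s (x, β)))

namespace BoundedKernels

variable {a r D : ℝ}

lemma coe_eq_adjoint (hB : BoundedKernels H H₁ k₁ k₂ a r D) (s : H) (β : T) (x : S) :
    s (x, β) = (RKHS.kerFun H₁ x).adjoint ((sliceEmb H H₁ β).adjoint s) := by
  rw [RKHS.adjoint_kerFun, hB.isProductKernel.adjoint_sliceEmb_apply]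

lemma norm_coe_le (hB : BoundedKernels H H₁ k₁ k₂ a r D) (s : H) (β : T) (x : S) :
    ‖s (x, β)‖ ≤ r * (a * ‖s‖) := by
  rw [hB.coe_eq_adjoint]
  refine (ContinuousLinearMap.le_opNorm _ _).trans ?_
  rw [LinearIsometryEquiv.norm_map]
  refine mul_le_mul (hB.norm_kerFun x) ?_ (norm_nonneg _) hB.nonneg_ker
  refine (ContinuousLinearMap.le_opNorm _ _).trans ?_
  rw [LinearIsometryEquiv.norm_map]
  exact mul_le_mul_of_nonneg_right (hB.norm_sliceEmb β) (norm_nonneg _)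

lemma norm_coe_sub_le (hB : BoundedKernels H H₁ k₁ k₂ a r D) (s : H) (β β' : T) (x : S) :
    ‖s (x, β) - s (x, β')‖ ≤ r * (‖sliceEmb H H₁ β - sliceEmb H H₁ β'‖ * ‖s‖) := by
  rw [hB.coe_eq_adjoint, hB.coe_eq_adjoint, ← map_sub, ← _root_.sub_apply, ← map_sub]
  refine (ContinuousLinearMap.le_opNorm _ _).trans ?_
  rw [LinearIsometryEquiv.norm_map]
  refine mul_le_mul (hB.norm_kerFun x) ?_ (norm_nonneg _) hB.nonneg_ker
  refine (ContinuousLinearMap.le_opNorm _ _).trans ?_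
  rw [LinearIsometryEquiv.norm_map]

lemma norm_scoreTerm_le (hB : BoundedKernels H H₁ k₁ k₂ a r D) (s : H) (β : T) {x : S}
    (hx : (x : Euc d) ∈ interior S) :
    ‖scoreTerm H₁ s β x‖ ≤ a * (D + r * (r * (a * ‖s‖))) := by
  refine (ContinuousLinearMap.le_opNorm _ _).trans ?_
  refine mul_le_mul (hB.norm_sliceEmb β) ?_ (norm_nonneg _) hB.nonneg_slice
  refine (norm_add_le _ _).trans (add_le_add (hB.norm_divFeature x hx) ?_)
  refine (ContinuousLinearMap.le_opNorm _ _).trans ?_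
  exact mul_le_mul (hB.norm_kerFun x) (hB.norm_coe_le s β x) (norm_nonneg _) hB.nonneg_ker

/-- The vector `β` occurs in the outer embedding and in the evaluation of `s`. Each change is
controlled by the same difference of embeddings, whence the factor `2`. -/
lemma norm_scoreTerm_sub_le (hB : BoundedKernels H H₁ k₁ k₂ a r D) (s : H) (β β' : T) {x : S}
    (hx : (x : Euc d) ∈ interior S) :
    ‖scoreTerm H₁ s β x - scoreTerm H₁ s β' x‖ ≤
      ‖sliceEmb H H₁ β - sliceEmb H H₁ β'‖ * (D + 2 * (r * (r * (a * ‖s‖)))) := by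
  set δ := ‖sliceEmb H H₁ β - sliceEmb H H₁ β'‖
  have h1 : scoreTerm H₁ s β x - scoreTerm H₁ s β' x =
      (sliceEmb H H₁ β - sliceEmb H H₁ β') (divFeature H₁ (x : Euc d) +
        RKHS.kerFun H₁ x (s (x, β))) +
      sliceEmb H H₁ β' (RKHS.kerFun H₁ x (s (x, β) - s (x, β'))) := by
    simp only [scoreTerm, _root_.sub_apply, map_add, map_sub]
    abel
  have h2 : ‖divFeature H₁ (x : Euc d) + RKHS.kerFun H₁ x (s (x, β))‖ ≤
      D + r * (r * (a * ‖s‖)) := by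
    refine (norm_add_le _ _).trans (add_le_add (hB.norm_divFeature x hx) ?_)
    refine (ContinuousLinearMap.le_opNorm _ _).trans ?_
    exact mul_le_mul (hB.norm_kerFun x) (hB.norm_coe_le s β x) (norm_nonneg _) hB.nonneg_ker
  have h3 : ‖sliceEmb H H₁ β' (RKHS.kerFun H₁ x (s (x, β) - s (x, β')))‖ ≤
      a * (r * (r * (δ * ‖s‖))) := by
    refine (ContinuousLinearMap.le_opNorm _ _).trans ?_
    refine mul_le_mul (hB.norm_sliceEmb β') ?_ (norm_nonneg _) hB.nonneg_slice
    refine (ContinuousLinearMap.le_opNorm _ _).trans ?_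
    exact mul_le_mul (hB.norm_kerFun x) (hB.norm_coe_sub_le s β β' x) (norm_nonneg _)
      hB.nonneg_ker
  rw [h1]
  calc _ ≤ δ * (D + r * (r * (a * ‖s‖))) + a * (r * (r * (δ * ‖s‖))) := by
        refine (norm_add_le _ _).trans (add_le_add ?_ h3)
        exact (ContinuousLinearMap.le_opNorm _ _).trans
          (mul_le_mul_of_nonneg_left h2 (norm_nonneg _))
    _ = _ := by ring

lemma continuous_coe_slice (hB : BoundedKernels H H₁ k₁ k₂ a r D) (s : H) (β : T) :
    Continuous fun x : S => s (x, β) := by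
  have h := continuous_coe_of_continuous_kerFun hB.continuous_kerFun ((sliceEmb H H₁ β).adjoint s)
  have h2 : ⇑((sliceEmb H H₁ β).adjoint s) = fun x : S => s (x, β) :=
    funext fun x => hB.isProductKernel.adjoint_sliceEmb_apply β s x
  rwa [h2] at h

lemma aestronglyMeasurable_scoreTerm (hB : BoundedKernels H H₁ k₁ k₂ a r D) (hS : IsClosed S)
    (hnull : (volume : Measure (Euc d)) (frontier S) = 0) (s : H) (β : T) (β' : Euc m) :
    AEStronglyMeasurable (scoreTerm H₁ s β) (densityMeasure S p β') := by
  refine (sliceEmb H H₁ β).continuous.comp_aestronglyMeasurable (AEStronglyMeasurable.add ?_ ?_)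
  · have h1 := (stronglyMeasurable_indicator_divFeature hB.isProductKernel.fst hB.contDiffOn
      hS.measurableSet hB.continuous_kerFun).comp_measurable
      (measurable_subtype_coe (p := fun x => x ∈ S))
    refine h1.aestronglyMeasurable.congr ?_
    filter_upwards [ae_densityMeasure_mem_interior hS hnull β'] with x hx
    exact Set.indicator_of_mem hx _
  · exact (hB.continuous_kerFun.clm_apply (hB.continuous_coe_slice s β)).aestronglyMeasurable

lemma integrable_scoreTerm (hB : BoundedKernels H H₁ k₁ k₂ a r D) (hS : IsClosed S)
    (hnull : (volume : Measure (Euc d)) (frontier S) = 0) (s : H) (β : T) (β' : Euc m)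
    [IsFiniteMeasure (densityMeasure S p β')] :
    Integrable (scoreTerm H₁ s β) (densityMeasure S p β') := by
  refine Integrable.of_bound (hB.aestronglyMeasurable_scoreTerm hS hnull s β β')
    (a * (D + r * (r * (a * ‖s‖)))) ?_
  filter_upwards [ae_densityMeasure_mem_interior hS hnull β'] with x hx
  exact hB.norm_scoreTerm_le s β hx

/-- The score term at the true score is centred. -/
lemma integral_scoreTerm_eq_zero (hB : BoundedKernels H H₁ k₁ k₂ a r D)
    (hk : KernelRegularity S T k₁ k₂) (hp : DensityRegularity S T k₁ p)
    (hS : closure (interior S) = S) (hnull : (volume : Measure (Euc d)) (frontier S) = 0) {s₀ : H}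
    (hs₀ : ∀ (x : S) (β : T), (x : Euc d) ∈ interior S → s₀ (x, β) = steinScore p x β) (β : T) :
    ∫ x, scoreTerm H₁ s₀ β x ∂(densityMeasure S p β) = 0 := by
  obtain ⟨κ₁, hκ₁⟩ := hk.bdd_fst
  obtain ⟨κ₃, hκ₃⟩ := hk.bdd_deriv_fst
  have hcl : IsClosed S := hS ▸ isClosed_closure
  have := hp.isProb β β.2
  -- Tested against `t`, the claim is Stein's identity for the slices `f` of `t` and `g` of `s₀`.
  refine ext_inner_left ℝ fun t => ?_
  rw [inner_zero_right, ← integral_inner (hB.integrable_scoreTerm hcl hnull s₀ β β)]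
  set f := (sliceEmb H H₁ β).adjoint t
  set g := (sliceEmb H H₁ β).adjoint s₀
  have h := setIntegral_stein hcl hB.isProductKernel.fst hB.contDiffOn hB.continuous_kerFun hκ₁ hκ₃
    (hp.continuousOn β β.2) (hp.pos β β.2) (hp.differentiableOn β β.2)
    (hp.integrableOn hS hnull β.2) (hp.decay β β.2) (hp.boundary β β.2) (g := g)
    (fun x hx => by rw [hB.isProductKernel.adjoint_sliceEmb_apply]; exact hs₀ x β hx) f
  rw [← hp.integral_eq hS hnull β.2] at h
  rw [← h]
  refine integral_congr_ae (ae_of_all _ fun x => ?_)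
  simp only [scoreTerm]
  rw [← ContinuousLinearMap.adjoint_inner_left, inner_add_right, real_inner_comm,
    RKHS.inner_kerFun, Subtype.val_injective.extend_apply, Subtype.val_injective.extend_apply,
    hB.isProductKernel.adjoint_sliceEmb_apply β s₀, real_inner_comm (f x)]

lemma integrable_kerFun_comp_adjoint (hB : BoundedKernels H H₁ k₁ k₂ a r D) (β : T) (β' : Euc m)
    [IsFiniteMeasure (densityMeasure S p β')] :
    Integrable (fun x : S => (RKHS.kerFun H (x, β)).comp
      (ContinuousLinearMap.adjoint (RKHS.kerFun H (x, β)))) (densityMeasure S p β') := by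
  have hc : Continuous fun x : S => RKHS.kerFun H (x, β) := by
    simp only [hB.isProductKernel.kerFun_eq_comp]
    exact continuous_const.clm_comp hB.continuous_kerFun
  have hn : ∀ x : S, ‖RKHS.kerFun H (x, β)‖ ≤ a * r := fun x => by
    rw [hB.isProductKernel.kerFun_eq_comp]
    exact (ContinuousLinearMap.opNorm_comp_le _ _).trans (mul_le_mul (hB.norm_sliceEmb β)
      (hB.norm_kerFun x) (norm_nonneg _) hB.nonneg_slice)
  have har : 0 ≤ a * r := mul_nonneg hB.nonneg_slice hB.nonneg_ker
  refine Integrable.of_bound ?_ ((a * r) * (a * r)) (ae_of_all _ fun x => ?_)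
  · exact (hc.clm_comp (ContinuousLinearMap.adjoint.continuous.comp hc)).aestronglyMeasurable
  · refine (ContinuousLinearMap.opNorm_comp_le _ _).trans ?_
    rw [LinearIsometryEquiv.norm_map]
    exact mul_le_mul (hn x) (hn x) (norm_nonneg _) har

lemma covOperator_apply (hB : BoundedKernels H H₁ k₁ k₂ a r D) (hp : DensityRegularity S T k₁ p)
    {n : ℕ} (B : Fin n → T) (s : H) :
    covOperator H p B s = (1 / (n : ℝ)) • ∑ i, ∫ x : S, RKHS.kerFun H (x, B i) (s (x, B i))
      ∂(densityMeasure S p (B i)) := by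
  rw [covOperator, _root_.smul_apply, _root_.sum_apply]
  congr 1
  refine Finset.sum_congr rfl fun i _ => ?_
  have := hp.isProb (B i) (B i).2
  rw [ContinuousLinearMap.integral_apply (hB.integrable_kerFun_comp_adjoint (B i) (B i))]
  simp

/-- The form of the operator is an averaged `L²` inner product of slices; symmetry, positivity and
the description of the kernel all come from it. -/
lemma inner_covOperator (hB : BoundedKernels H H₁ k₁ k₂ a r D) (hp : DensityRegularity S T k₁ p)
    {n : ℕ} (B : Fin n → T) (s t : H) :
    inner ℝ (covOperator H p B s) t = (1 / (n : ℝ)) * ∑ i, ∫ x : S,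
      inner ℝ (s (x, B i)) (t (x, B i)) ∂(densityMeasure S p (B i)) := by
  rw [hB.covOperator_apply hp, inner_smul_left, sum_inner, conj_trivial]
  congr 1
  refine Finset.sum_congr rfl fun i _ => ?_
  have := hp.isProb (B i) (B i).2
  have hi : Integrable (fun x : S => RKHS.kerFun H (x, B i) (s (x, B i)))
      (densityMeasure S p (B i)) := by
    have := (hB.integrable_kerFun_comp_adjoint (p := p) (B i) (B i)).apply_continuousLinearMap s
    simpa using this
  rw [real_inner_comm, ← integral_inner hi]
  refine integral_congr_ae (ae_of_all _ fun x => ?_)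
  simp [real_inner_comm]

lemma inner_covOperator_self_nonneg (hB : BoundedKernels H H₁ k₁ k₂ a r D)
    (hp : DensityRegularity S T k₁ p) {n : ℕ} (B : Fin n → T) (s : H) :
    0 ≤ inner ℝ (covOperator H p B s) s := by
  rw [hB.inner_covOperator hp]
  refine mul_nonneg (by positivity) (Finset.sum_nonneg fun i _ => integral_nonneg fun x => ?_)
  exact real_inner_self_nonneg

lemma inner_covOperator_comm (hB : BoundedKernels H H₁ k₁ k₂ a r D)
    (hp : DensityRegularity S T k₁ p) {n : ℕ} (B : Fin n → T) (s t : H) :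
    inner ℝ (covOperator H p B s) t = inner ℝ s (covOperator H p B t) := by
  rw [real_inner_comm (covOperator H p B t), hB.inner_covOperator hp, hB.inner_covOperator hp]
  simp only [real_inner_comm]

/-- The mean of the score terms is the image of the error under the covariance operator. -/
lemma mean_integral_scoreTerm (hB : BoundedKernels H H₁ k₁ k₂ a r D)
    (hk : KernelRegularity S T k₁ k₂) (hp : DensityRegularity S T k₁ p)
    (hS : closure (interior S) = S) (hnull : (volume : Measure (Euc d)) (frontier S) = 0) {s₀ : H}
    (hs₀ : ∀ (x : S) (β : T), (x : Euc d) ∈ interior S → s₀ (x, β) = steinScore p x β) {n : ℕ}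
    (B : Fin n → T) (s : H) :
    (1 / (n : ℝ)) • ∑ i, ∫ x, scoreTerm H₁ s (B i) x ∂(densityMeasure S p (B i)) =
      covOperator H p B (s - s₀) := by
  have hcl : IsClosed S := hS ▸ isClosed_closure
  rw [hB.covOperator_apply hp]
  congr 1
  refine Finset.sum_congr rfl fun i _ => ?_
  have := hp.isProb (B i) (B i).2
  -- Subtracting the centred term at `s₀` cancels the divergence representer and leaves the part
  -- linear in `s - s₀`.
  rw [← sub_zero (∫ x, scoreTerm H₁ s (B i) x ∂(densityMeasure S p (B i))),
    ← hB.integral_scoreTerm_eq_zero hk hp hS hnull hs₀ (B i),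
    ← integral_sub (hB.integrable_scoreTerm hcl hnull s _ _)
      (hB.integrable_scoreTerm hcl hnull s₀ _ _)]
  refine integral_congr_ae (ae_of_all _ fun x => ?_)
  simp only [scoreTerm]
  rw [← map_sub, add_sub_add_left_eq_sub, ← map_sub, hB.isProductKernel.sliceEmb_kerFun]
  simp

/-- The kernel of the covariance operator consists of functions with vanishing slices. -/
lemma coe_eq_zero_of_covOperator_eq_zero (hB : BoundedKernels H H₁ k₁ k₂ a r D)
    (hp : DensityRegularity S T k₁ p) (hS : closure (interior S) = S) {n : ℕ} (B : Fin n → T)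
    {s : H} (hs : covOperator H p B s = 0) (i : Fin n) (x : S) : s (x, B i) = 0 := by
  have hcl : IsClosed S := hS ▸ isClosed_closure
  have hn : (n : ℝ) ≠ 0 := by
    have := i.pos
    positivity
  have h0 := hB.inner_covOperator hp B s s
  rw [hs, inner_zero_left] at h0
  have h1 : ∑ i, ∫ x : S, inner ℝ (s (x, B i)) (s (x, B i)) ∂(densityMeasure S p (B i)) = 0 := by
    rcases mul_eq_zero.1 h0.symm with h | h
    · exact absurd h (by positivity)
    · exact h
  have h2 := (Finset.sum_eq_zero_iff_of_nonneg fun i _ => integral_nonneg fun x =>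
    real_inner_self_nonneg).1 h1 i (Finset.mem_univ i)
  have := hp.isProb (B i) (B i).2
  have hcont := hB.continuous_coe_slice s (B i)
  have hint : Integrable (fun x : S => inner ℝ (s (x, B i)) (s (x, B i)))
      (densityMeasure S p (B i)) := by
    refine Integrable.of_bound (hcont.inner hcont).aestronglyMeasurable
      ((r * (a * ‖s‖)) * (r * (a * ‖s‖))) (ae_of_all _ fun x => ?_)
    refine (norm_inner_le_norm _ _).trans ?_
    have := hB.norm_coe_le s (B i) x
    exact mul_le_mul this this (norm_nonneg _) ((norm_nonneg _).trans this)
  -- The zero of the quadratic form gives vanishing almost everywhere for the density, hence for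
  -- Lebesgue measure in the interior since the density is positive there, hence everywhere on the
  -- interior by continuity, and on `S` by closure.
  have h3 : ∀ᵐ x : S ∂(densityMeasure S p (B i)), s (x, B i) = 0 := by
    filter_upwards [(integral_eq_zero_iff_of_nonneg (fun x => real_inner_self_nonneg) hint).1 h2]
      with x hx
    exact inner_self_eq_zero.1 hx
  have h4 : ∀ᵐ x : S ∂((volume : Measure (Euc d)).comap Subtype.val),
      (x : Euc d) ∈ interior S → s (x, B i) = 0 := by
    rw [densityMeasure, ae_withDensity_iff (hp.measurable (B i).2).ennreal_ofReal] at h3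
    filter_upwards [h3] with x hx hxi
    exact hx (by simpa using hp.pos (B i) (B i).2 x hxi)
  set g := Function.extend Subtype.val (fun x : S => s (x, B i)) 0
  have hg : ∀ x : S, g x = s (x, B i) := fun x => Subtype.val_injective.extend_apply _ _ _
  have hgc : ContinuousOn g S := by
    rw [continuousOn_iff_continuous_domRestrict]
    convert hcont using 1
    exact funext hg
  have h5 : ∀ᵐ y ∂((volume : Measure (Euc d)).restrict S), y ∈ interior S → g y = 0 := by
    rw [ae_restrict_iff_subtype hcl.measurableSet]
    filter_upwards [h4] with x hx hxi
    rw [hg]; exact hx hxi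
  have h6 : g =ᵐ[(volume : Measure (Euc d)).restrict (interior S)] fun _ => 0 := by
    filter_upwards [ae_restrict_of_ae_restrict_of_subset interior_subset h5,
      ae_restrict_mem isOpen_interior.measurableSet] with y hy hyi using hy hyi
  have h7 : Set.EqOn g (fun _ => 0) (interior S) :=
    Measure.eqOn_open_of_ae_eq h6 isOpen_interior (hgc.mono interior_subset) continuousOn_const
  have h8 : Set.EqOn g (fun _ => 0) S :=
    h7.of_subset_closure hgc continuousOn_const interior_subset hS.ge
  rw [← hg]
  exact h8 x.2

end BoundedKernels

end Setting

/-! ### From Euclidean to kernel distance of latent vectors. -/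

section KernelDist

lemma kernelDist_self {T : Type*} (k : T → T → ℝ) (β : T) : kernelDist k β β = 0 := by
  simp [kernelDist]

/-- Compactness makes the kernel distance uniformly continuous, and it vanishes on the diagonal:
compare `(β, β')` with `(β', β')`. -/
lemma exists_kernelDist_lt {m : ℕ} {T : Set (Euc m)} (hT : IsCompact T) {k₂ : Euc m → Euc m → ℝ}
    (hk : ContinuousOn (fun z : Euc m × Euc m => k₂ z.1 z.2) (T ×ˢ T)) {ε : ℝ} (hε : 0 < ε) :
    ∃ δ > 0, ∀ β β' : T, ‖(β : Euc m) - β'‖ < δ →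
      kernelDist (fun β β' : T => k₂ β β') β β' < ε := by
  have := isCompact_iff_compactSpace.1 hT
  have h : ∀ u v : T × T → T, Continuous u → Continuous v →
      Continuous fun z => k₂ (u z) (v z) := fun u v hu hv =>
    hk.comp_continuous (f := fun z => ((u z : Euc m), (v z : Euc m))) (by fun_prop)
      fun z => ⟨(u z).2, (v z).2⟩
  have hc : Continuous fun z : T × T => kernelDist (fun β β' : T => k₂ β β') z.1 z.2 := by
    refine Real.continuous_sqrt.comp ((((h _ _ ?_ ?_).sub (h _ _ ?_ ?_)).sub (h _ _ ?_ ?_)).add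
      (h _ _ ?_ ?_)) <;> fun_prop
  obtain ⟨δ, hδ, hd⟩ := Metric.uniformContinuous_iff.1
    (CompactSpace.uniformContinuous_of_continuous hc) ε hε
  refine ⟨δ, hδ, fun β β' hβ => ?_⟩
  have h1 : dist (β, β') (β', β') < δ := by
    simpa [Prod.dist_eq, Subtype.dist_eq, dist_eq_norm, hδ] using hβ
  have h2 := hd h1
  rw [kernelDist_self, Real.dist_eq, sub_zero] at h2
  exact (le_abs_self _).trans_lt h2

/-- Consistency in the kernel distance. -/
lemma IsLittleOp.kernelDist {m : ℕ} {T : Set (Euc m)} (hT : IsCompact T)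
    {k₂ : Euc m → Euc m → ℝ} (hk : ContinuousOn (fun z : Euc m × Euc m => k₂ z.1 z.2) (T ×ˢ T))
    {Ω : ℕ → Type*} [∀ n, MeasurableSpace (Ω n)] {P : ∀ n, Measure (Ω n)}
    {B : ∀ n : ℕ, Fin n → T} {Bhat : ∀ n : ℕ, Fin n → Ω n → T}
    (hBhat : IsLittleOp P fun n ω =>
      twoInftyNorm fun i => (Bhat n i ω : Euc m) - (B n i : Euc m)) :
    IsLittleOp P fun n ω => ⨆ i, ENNReal.ofReal
      (_root_.kernelDist (fun β β' : T => k₂ β β') (Bhat n i ω) (B n i)) := by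
  intro ε hε
  obtain ⟨ε', hε'0, hε'⟩ := ENNReal.lt_iff_exists_real_btwn.1 hε
  have hε'pos : 0 < ε' := ENNReal.ofReal_pos.1 hε'.1
  obtain ⟨δ, hδ, hd⟩ := exists_kernelDist_lt hT hk hε'pos
  refine tendsto_of_tendsto_of_tendsto_of_le_of_le tendsto_const_nhds
    (hBhat (ENNReal.ofReal δ) (ENNReal.ofReal_pos.2 hδ)) (fun _ => zero_le) fun n => ?_
  refine measure_mono fun ω (hω : ε ≤ _) => ?_
  by_contra hlt
  have hlt' : twoInftyNorm (fun i => (Bhat n i ω : Euc m) - (B n i : Euc m)) < ENNReal.ofReal δ :=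
    not_le.1 hlt
  refine absurd hω (not_le.2 (lt_of_le_of_lt (iSup_le fun i => ?_) hε'.2))
  refine ENNReal.ofReal_le_ofReal (hd _ _ ?_).le
  have h1 : ‖(Bhat n i ω : Euc m) - (B n i : Euc m)‖ₑ < ENNReal.ofReal δ :=
    (le_iSup (fun i => ‖(Bhat n i ω : Euc m) - (B n i : Euc m)‖ₑ) i).trans_lt hlt'
  rw [← ofReal_norm] at h1
  exact (ENNReal.ofReal_lt_ofReal_iff hδ).1 h1

end KernelDist

/-! ### The empirical normal equation and the error of the estimator. -/

section Empirical

variable {d m : ℕ} {S : Set (Euc d)} {T : Set (Euc m)} {k₁ : Euc d → Euc d → ℝ}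
  {k₂ : Euc m → Euc m → ℝ} {p : Euc d → Euc m → ℝ}
variable {H : Type*} [NormedAddCommGroup H] [InnerProductSpace ℝ H] [CompleteSpace H]
  [RKHS ℝ H (S × T) (Euc d)]
variable {H₁ : Type*} [NormedAddCommGroup H₁] [InnerProductSpace ℝ H₁] [CompleteSpace H₁]
  [RKHS ℝ H₁ S (Euc d)]

variable (H) in
/-- The empirical covariance operator. -/
def empiricalCov {n : ℕ} (x : Fin n → S) (b : Fin n → T) : H →L[ℝ] H :=
  (1 / (n : ℝ)) • ∑ i, (RKHS.kerFun H (x i, b i)).comp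
    (ContinuousLinearMap.adjoint (RKHS.kerFun H (x i, b i)))

variable (H H₁) in
/-- The representer of the empirical mean of the divergence. -/
def empiricalDiv {n : ℕ} (x : Fin n → S) (b : Fin n → T) : H :=
  (1 / (n : ℝ)) • ∑ i, sliceEmb H H₁ (b i) (divFeature H₁ (x i : Euc d))

lemma empiricalCov_apply {n : ℕ} (x : Fin n → S) (b : Fin n → T) (s : H) :
    empiricalCov H x b s = (1 / (n : ℝ)) • ∑ i, RKHS.kerFun H (x i, b i) (s (x i, b i)) := by
  rw [empiricalCov, _root_.smul_apply, _root_.sum_apply]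
  simp

lemma inner_empiricalCov {n : ℕ} (x : Fin n → S) (b : Fin n → T) (s t : H) :
    inner ℝ (empiricalCov H x b s) t =
      (1 / (n : ℝ)) * ∑ i, inner ℝ (s (x i, b i)) (t (x i, b i)) := by
  rw [empiricalCov_apply, inner_smul_left, sum_inner, conj_trivial]
  simp

namespace BoundedKernels

variable {a r D : ℝ}

lemma empiricalCov_add_empiricalDiv (hB : BoundedKernels H H₁ k₁ k₂ a r D) {n : ℕ}
    (x : Fin n → S) (b : Fin n → T) (s : H) :
    empiricalCov H x b s + empiricalDiv H H₁ x b =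
      (1 / (n : ℝ)) • ∑ i, scoreTerm H₁ s (b i) (x i) := by
  rw [empiricalCov_apply, empiricalDiv, ← smul_add, ← Finset.sum_add_distrib]
  simp only [scoreTerm, map_add, hB.isProductKernel.sliceEmb_kerFun, add_comm]

/-- The divergence is represented by an inner product only at interior points, hence the hypothesis
on the sample. -/
lemma scoreObjective_eq (hB : BoundedKernels H H₁ k₁ k₂ a r D) {n : ℕ} (lam : ℝ)
    {x : Fin n → S} (hx : ∀ i, (x i : Euc d) ∈ interior S) (b : Fin n → T) (s : H) :
    scoreObjective lam x b s = (1 / 2) * inner ℝ (empiricalCov H x b s) s +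
      inner ℝ (empiricalDiv H H₁ x b) s + lam / 2 * ‖s‖ ^ 2 := by
  have h : ∀ i, divergence (fun y => s (y, b i)) (x i : Euc d) =
      inner ℝ (sliceEmb H H₁ (b i) (divFeature H₁ (x i : Euc d))) s := by
    intro i
    rw [← ContinuousLinearMap.adjoint_inner_right,
      inner_divFeature hB.isProductKernel.fst hB.contDiffOn _ (hx i)]
    congr 1
    exact funext fun y => (hB.isProductKernel.adjoint_sliceEmb_apply (b i) s y).symm
  rw [scoreObjective, inner_empiricalCov, empiricalDiv, inner_smul_left, sum_inner, conj_trivial,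
    Finset.sum_add_distrib, ← Finset.mul_sum]
  simp only [h, real_inner_self_eq_norm_sq]
  ring

/-- The score-matching estimator is the unique solution of the normal equation. -/
lemma exists_isScoreMinimizer_iff (hB : BoundedKernels H H₁ k₁ k₂ a r D) {n : ℕ} {lam : ℝ}
    (hlam : 0 < lam) {x : Fin n → S} (hx : ∀ i, (x i : Euc d) ∈ interior S) (b : Fin n → T) :
    ∃ s : H, empiricalCov H x b s + lam • s = -empiricalDiv H H₁ x b ∧
      ∀ t, IsScoreMinimizer lam x b t ↔ t = s := by
  refine exists_forall_isMin_iff (fun z => ?_) (fun z w => ?_) hlam _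
    (hB.scoreObjective_eq lam hx b)
  · rw [inner_empiricalCov]
    exact mul_nonneg (by positivity) (Finset.sum_nonneg fun i _ => real_inner_self_nonneg)
  · rw [real_inner_comm (empiricalCov H x b w), inner_empiricalCov, inner_empiricalCov]
    simp only [real_inner_comm]

/-- The residual of `s` in the empirical equation is the mean of its score terms at `b` plus `lam •
s`. At `B` the expected mean is `C_B (s - s₀) = -lam • s`, so the residual splits into a centred
fluctuation `R₁` at the true vectors and a perturbation `R₂`. As `b` may depend on the sample, `R₂`
is bounded pointwise, without probability. -/
lemma norm_estimator_sub_le (hB : BoundedKernels H H₁ k₁ k₂ a r D)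
    (hk : KernelRegularity S T k₁ k₂) (hp : DensityRegularity S T k₁ p)
    (hS : closure (interior S) = S) (hnull : (volume : Measure (Euc d)) (frontier S) = 0) {s₀ : H}
    (hs₀ : ∀ (x : S) (β : T), (x : Euc d) ∈ interior S → s₀ (x, β) = steinScore p x β) {n : ℕ}
    (hn : n ≠ 0) (B b : Fin n → T) {x : Fin n → S} (hx : ∀ i, (x i : Euc d) ∈ interior S)
    {lam : ℝ} {s t : H}
    (hs : covOperator H p B s + lam • s = covOperator H p B s₀)
    (ht : empiricalCov H x b t + lam • t = -empiricalDiv H H₁ x b) {δ : ℝ}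
    (hδ : ∀ i, ‖sliceEmb H H₁ (b i) - sliceEmb H H₁ (B i)‖ ≤ δ) :
    lam * ‖t - s‖ ≤ ‖(1 / (n : ℝ)) • ∑ i, (scoreTerm H₁ s (B i) (x i) -
        ∫ y, scoreTerm H₁ s (B i) y ∂(densityMeasure S p (B i)))‖ +
      δ * (D + 2 * (r * (r * (a * ‖s‖)))) := by
  set M := D + 2 * (r * (r * (a * ‖s‖)))
  have hM : 0 ≤ M := by
    have := hB.nonneg_slice
    have := hB.nonneg_ker
    have := hB.nonneg_div
    positivity
  set R₁ := (1 / (n : ℝ)) • ∑ i, (scoreTerm H₁ s (B i) (x i) -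
        ∫ y, scoreTerm H₁ s (B i) y ∂(densityMeasure S p (B i))) with hR₁
  set R₂ := (1 / (n : ℝ)) • ∑ i, (scoreTerm H₁ s (b i) (x i) - scoreTerm H₁ s (B i) (x i)) with hR₂
  have hmean := hB.mean_integral_scoreTerm hk hp hS hnull hs₀ B s
  have hmean' : covOperator H p B (s - s₀) = -(lam • s) := by
    rw [map_sub, ← hs]; abel
  have heq : empiricalCov H x b (t - s) + lam • (t - s) = -(R₁ + R₂) := by
    have h1 : R₁ + R₂ = empiricalCov H x b s + empiricalDiv H H₁ x b + lam • s := by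
      rw [hR₁, hR₂, Finset.sum_sub_distrib, Finset.sum_sub_distrib, smul_sub, smul_sub, hmean,
        hmean', ← hB.empiricalCov_add_empiricalDiv x b s]
      abel
    rw [h1, map_sub, smul_sub]
    calc _ = (empiricalCov H x b t + lam • t) - (empiricalCov H x b s + lam • s) := by abel
      _ = _ := by rw [ht]; abel
  have hpos : ∀ z : H, 0 ≤ inner ℝ (empiricalCov H x b z) z := fun z => by
    rw [inner_empiricalCov]
    exact mul_nonneg (by positivity) (Finset.sum_nonneg fun i _ => real_inner_self_nonneg)
  have h2 := mul_norm_le_of_add_smul_eq hpos heq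
  rw [norm_neg] at h2
  refine h2.trans ((norm_add_le _ _).trans (add_le_add le_rfl ?_))
  rw [hR₂, norm_smul, Real.norm_of_nonneg (by positivity)]
  have hn' : (0 : ℝ) < n := by positivity
  have h3 : ‖∑ i, (scoreTerm H₁ s (b i) (x i) - scoreTerm H₁ s (B i) (x i))‖ ≤ n * (δ * M) := by
    refine (norm_sum_le _ _).trans ?_
    calc _ ≤ ∑ _i : Fin n, δ * M := Finset.sum_le_sum fun i _ =>
          (hB.norm_scoreTerm_sub_le s (b i) (B i) (hx i)).trans
            (mul_le_mul_of_nonneg_right (hδ i) hM)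
      _ = n * (δ * M) := by simp
  calc _ ≤ 1 / (n : ℝ) * (n * (δ * M)) := by gcongr
    _ = δ * M := by field_simp

/-- The slices of the estimator are as close to those of the truth as the estimator is to any
element with the same true slices. -/
lemma rkhsNorm_slice_sub_le (hB : BoundedKernels H H₁ k₁ k₂ a r D) {s₀ u t : H} {β β' : T}
    (hu : ∀ x : S, u (x, β) = s₀ (x, β)) :
    rkhsNorm H₁ (fun x : S => t (x, β') - s₀ (x, β)) ≤
      ENNReal.ofReal (a * ‖t - u‖ + ‖sliceEmb H H₁ β' - sliceEmb H H₁ β‖ * ‖u‖) := by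
  -- Two errors: that of the function, seen through a bounded slice map, and that of the slice map,
  -- applied to the comparison element `u`.
  set h : H₁ := (sliceEmb H H₁ β').adjoint (t - u) +
    (sliceEmb H H₁ β' - sliceEmb H H₁ β).adjoint u with hh
  have hcoe : ⇑h = fun x : S => t (x, β') - s₀ (x, β) := by
    funext x
    have h1 : h = (sliceEmb H H₁ β').adjoint t - (sliceEmb H H₁ β).adjoint u := by
      rw [hh, map_sub, map_sub, _root_.sub_apply]
      abel
    rw [h1, RKHS.coe_sub, Pi.sub_apply, hB.isProductKernel.adjoint_sliceEmb_apply,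
      hB.isProductKernel.adjoint_sliceEmb_apply, hu]
  refine (iInf₂_le h hcoe).trans ?_
  rw [← ofReal_norm]
  refine ENNReal.ofReal_le_ofReal ((norm_add_le _ _).trans (add_le_add ?_ ?_))
  · refine (ContinuousLinearMap.le_opNorm _ _).trans ?_
    rw [LinearIsometryEquiv.norm_map]
    exact mul_le_mul_of_nonneg_right (hB.norm_sliceEmb β') (norm_nonneg _)
  · refine (ContinuousLinearMap.le_opNorm _ _).trans ?_
    rw [LinearIsometryEquiv.norm_map]

end BoundedKernels

end Empirical
end

/-! ### Combination of the error bounds. -/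

theorem theorem1 {d m : ℕ}
    -- the domains of the observations and of the latent vectors
    (S : Set (Euc d)) (hS : closure (interior S) = S) (hS_null : volume (frontier S) = 0)
    (T : Set (Euc m)) (hT : IsCompact T)
    -- the scalar kernels
    (k₁ : Euc d → Euc d → ℝ) (k₂ : Euc m → Euc m → ℝ)
    (hk₁ : IsKernelOn S k₁) (hk₂ : IsKernelOn T k₂) (hk : KernelRegularity S T k₁ k₂)
    -- the reproducing kernel Hilbert space of `k₁ k₂ I_d`
    {H : Type*} [NormedAddCommGroup H] [InnerProductSpace ℝ H] [CompleteSpace H]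
    [RKHS ℝ H (S × T) (Euc d)]
    (hH : ∀ z z' : S × T, RKHS.kernel H z z' =
      (k₁ z.1 z'.1 * k₂ z.2 z'.2) • ContinuousLinearMap.id ℝ (Euc d))
    -- the reproducing kernel Hilbert space of `k₁ I_d`
    {H₁ : Type*} [NormedAddCommGroup H₁] [InnerProductSpace ℝ H₁] [CompleteSpace H₁]
    [RKHS ℝ H₁ S (Euc d)]
    (hH₁ : ∀ x x' : S, RKHS.kernel H₁ x x' = k₁ x x' • ContinuousLinearMap.id ℝ (Euc d))
    -- the densities and their score
    (p : Euc d → Euc m → ℝ) (hp : DensityRegularity S T k₁ p)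
    (s₀ : H) (hs₀ : ∀ (x : S) (β : T), (x : Euc d) ∈ interior S → s₀ (x, β) = steinScore p x β)
    -- the latent vectors, the observations and the estimated latent vectors
    (B : ∀ n : ℕ, Fin n → T)
    {Ω : ℕ → Type*} [∀ n, MeasurableSpace (Ω n)]
    (P : ∀ n, Measure (Ω n)) [∀ n, IsProbabilityMeasure (P n)]
    (X : ∀ n : ℕ, Fin n → Ω n → S) (hX : ∀ n i, Measurable (X n i))
    (hX_indep : ∀ n, iIndepFun (X n) (P n))
    (hX_law : ∀ n i, (P n).map (X n i) = densityMeasure S p (B n i))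
    (Bhat : ∀ n : ℕ, Fin n → Ω n → T)
    -- consistency of the estimated latent vectors
    (hBhat : IsLittleOp P fun n ω => twoInftyNorm fun i => (Bhat n i ω : Euc m) - (B n i : Euc m))
    -- convergence of the covariance-type operators and of the projections
    (C : H →L[ℝ] H) (hC_compact : IsCompactOperator C) (hC_pos : C.IsPositive)
    (hC : Tendsto (fun n => covOperator H p (B n)) atTop (𝓝 C))
    (hC_proj : ∀ h : H, Tendsto
      (fun n => rangeProj (covOperator H p (B n)) (h - rangeProj C h)) atTop (𝓝 0)) :
    ∃ lam : ℕ → ℝ, (∀ n, 0 < lam n) ∧ Tendsto lam atTop (𝓝 0) ∧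
      (∀ n, ∀ᵐ ω ∂(P n), ∃! s : H,
        IsScoreMinimizer (lam n) (fun i => X n i ω) (fun i => Bhat n i ω) s) ∧
      IsLittleOp P fun n ω => ⨆ i : Fin n, rkhsNorm H₁ fun x : S =>
        scoreEstimator H (lam n) (fun i => X n i ω) (fun i => Bhat n i ω) (x, Bhat n i ω)
          - s₀ (x, B n i) := by
  have hcl : IsClosed S := hS ▸ isClosed_closure
  have hK : IsProductKernel H H₁ (fun x x' : S => k₁ x x') (fun β β' : T => k₂ β β') := ⟨hH₁, hH⟩
  obtain ⟨a, r, D, hB⟩ := hk.exists_boundedKernels hT hK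
  have ha := hB.nonneg_slice
  have hr := hB.nonneg_ker
  have hD := hB.nonneg_div
  obtain ⟨lam, hlam, hlam0, hlamsq, hrate⟩ :=
    (IsLittleOp.kernelDist hT hk.contDiffOn_snd.continuousOn hBhat).exists_rate
  have hint : ∀ n, ∀ᵐ ω ∂(P n), ∀ i, (X n i ω : Euc d) ∈ interior S := by
    intro n
    refine ae_all_iff.2 fun i => ?_
    have := ae_densityMeasure_mem_interior (p := p) hcl hS_null (B n i : Euc m)
    rw [← hX_law n i] at this
    exact ae_of_ae_map (hX n i).aemeasurable this
  refine ⟨lam, hlam, hlam0, fun n => ?_, ?_⟩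
  · filter_upwards [hint n] with ω hω
    obtain ⟨s, -, hs⟩ := hB.exists_isScoreMinimizer_iff (hlam n) hω fun i => Bhat n i ω
    exact ⟨s, (hs s).2 rfl, fun t ht => (hs t).1 ht⟩
  -- the population version of the estimator
  have hCpos := fun n => hB.inner_covOperator_self_nonneg hp (B n)
  choose s hs using fun n => exists_add_smul_eq (hCpos n) (hlam n) (covOperator H p (B n) s₀)
  -- The target in `H` is the projection, not `s₀`: the component of `s₀` in the kernel of `C_B` is
  -- not identified, but its slices at the true vectors vanish.
  set u : ℕ → H := fun n => rangeProj (covOperator H p (B n)) s₀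
  have htau : Tendsto (fun n => ‖s n - u n‖) atTop (𝓝 0) :=
    tendsto_norm_regularised_sub_rangeProj hCpos (fun n => hB.inner_covOperator_comm hp (B n)) hC
      (hC_proj s₀) hlam hlam0 hs
  have hus : ∀ n i (x : S), u n (x, B n i) = s₀ (x, B n i) := by
    intro n i x
    have h1 : covOperator H p (B n) (u n - s₀) = 0 := by
      rw [map_sub, apply_rangeProj (hB.inner_covOperator_comm hp (B n)), sub_self]
    have := hB.coe_eq_zero_of_covOperator_eq_zero hp hS (B n) h1 i x
    rw [RKHS.coe_sub, Pi.sub_apply, sub_eq_zero] at this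
    exact this
  -- Contractivity applied to `(C_B + lam)(s n - s₀) = -lam • s₀`. It makes the bound `M` on the
  -- score terms independent of `n`.
  have hsn : ∀ n, ‖s n‖ ≤ 2 * ‖s₀‖ := by
    intro n
    have h1 : covOperator H p (B n) (s n - s₀) + lam n • (s n - s₀) = -(lam n • s₀) := by
      rw [map_sub, smul_sub, ← hs n]; abel
    have h2 := mul_norm_le_of_add_smul_eq (hCpos n) h1
    rw [norm_neg, norm_smul, Real.norm_of_nonneg (hlam n).le] at h2
    have h3 := le_of_mul_le_mul_left h2 (hlam n)
    have h4 := norm_le_norm_add_norm_sub' (s n) s₀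
    linarith
  set M : ℝ := D + 2 * (r * (r * (a * (2 * ‖s₀‖))))
  have hM0 : 0 ≤ M := by positivity
  have hMs : ∀ n, D + 2 * (r * (r * (a * ‖s n‖))) ≤ M := fun n => by
    have := hsn n
    simp only [M]
    gcongr
  -- the centred score terms
  set f : ∀ n, Fin n → S → H := fun n i x => scoreTerm H₁ (s n) (B n i) x -
    ∫ y, scoreTerm H₁ (s n) (B n i) y ∂(densityMeasure S p (B n i))
  have hfbd : ∀ n i, ∀ᵐ x ∂(densityMeasure S p (B n i)), ‖f n i x‖ ≤ 2 * (a * M) := by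
    intro n i
    have := hp.isProb (B n i) (B n i).2
    have h1 : ∀ᵐ x ∂(densityMeasure S p (B n i)), ‖scoreTerm H₁ (s n) (B n i) x‖ ≤ a * M := by
      filter_upwards [ae_densityMeasure_mem_interior hcl hS_null (B n i : Euc m)] with x hx
      refine (hB.norm_scoreTerm_le (s n) (B n i) hx).trans
        (mul_le_mul_of_nonneg_left ((add_le_add le_rfl ?_).trans (hMs n)) ha)
      have : 0 ≤ r * (r * (a * ‖s n‖)) := by positivity
      linarith
    have h2 := norm_integral_le_of_norm_le_const h1
    rw [probReal_univ, mul_one] at h2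
    filter_upwards [h1] with x hx
    refine (norm_sub_le _ _).trans ?_
    linarith
  have hcheb : ∀ n, ∀ δ > 0, P n {ω | δ ≤ ‖(1 / (n : ℝ)) • ∑ i, f n i (X n i ω)‖} ≤
      ENNReal.ofReal ((2 * (a * M)) ^ 2 / (n * δ ^ 2)) := by
    intro n δ hδ
    refine measure_norm_mean_ge_le (hX n) (hX_indep n) (fun i => ?_) (by positivity) (fun i => ?_)
      (fun i => ?_) hδ
    · rw [hX_law]
      exact (hB.aestronglyMeasurable_scoreTerm hcl hS_null _ _ _).sub aestronglyMeasurable_const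
    · rw [hX_law]; exact hfbd n i
    · rw [hX_law]
      have := hp.isProb (B n i) (B n i).2
      rw [integral_sub (hB.integrable_scoreTerm hcl hS_null _ _ _) (integrable_const _)]
      simp
  -- the error on the good event
  have herr : ∀ n ≠ 0, ∀ η > 0, ∀ ω, (∀ i, (X n i ω : Euc d) ∈ interior S) →
      ‖(1 / (n : ℝ)) • ∑ i, f n i (X n i ω)‖ ≤ lam n * η →
      (∀ i, kernelDist (fun β β' : T => k₂ β β') (Bhat n i ω) (B n i) ≤ η * lam n) →
      ⨆ i : Fin n, rkhsNorm H₁ (fun x : S =>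
        scoreEstimator H (lam n) (fun i => X n i ω) (fun i => Bhat n i ω) (x, Bhat n i ω)
          - s₀ (x, B n i)) ≤
      ENNReal.ofReal (a * (η * (1 + M) + ‖s n - u n‖) + η * lam n * ‖s₀‖) := by
    intro n hn η hη ω hω hω1 hω2
    obtain ⟨t, ht, htmin⟩ := hB.exists_isScoreMinimizer_iff (hlam n) hω fun i => Bhat n i ω
    -- The choice operator returns the minimiser because one exists, and uniqueness identifies it
    -- with `t`.
    have hest : scoreEstimator H (lam n) (fun i => X n i ω) (fun i => Bhat n i ω) = t :=
      (htmin _).1 (Classical.epsilon_spec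
        (p := fun s : H => IsScoreMinimizer (lam n) (fun i => X n i ω) (fun i => Bhat n i ω) s)
        ⟨t, (htmin t).2 rfl⟩)
    have hslice : ∀ i, ‖sliceEmb H H₁ (Bhat n i ω) - sliceEmb H H₁ (B n i)‖ ≤ η * lam n :=
      fun i => (hK.norm_sliceEmb_sub_le _ _).trans (hω2 i)
    have h1 := hB.norm_estimator_sub_le hk hp hS hS_null hs₀ hn (B n) (fun i => Bhat n i ω) hω
      (hs n) ht hslice
    have h2 : ‖t - s n‖ ≤ η * (1 + M) := by
      refine le_of_mul_le_mul_left ?_ (hlam n)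
      calc _ ≤ _ := h1
        _ ≤ lam n * η + η * lam n * M :=
          add_le_add hω1 (mul_le_mul_of_nonneg_left (hMs n) (mul_nonneg hη.le (hlam n).le))
        _ = _ := by ring
    have h3 : ‖t - u n‖ ≤ η * (1 + M) + ‖s n - u n‖ := by
      have := norm_sub_le_norm_sub_add_norm_sub t (s n) (u n)
      linarith
    rw [hest]
    refine iSup_le fun i => (hB.rkhsNorm_slice_sub_le (hus n i)).trans
      (ENNReal.ofReal_le_ofReal (add_le_add (mul_le_mul_of_nonneg_left h3 ha) ?_))
    exact mul_le_mul (hslice i) (norm_rangeProj_apply_le _ _) (norm_nonneg _)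
      (mul_nonneg hη.le (hlam n).le)
  intro ε hε
  obtain ⟨e, he, heε⟩ : ∃ e : ℝ, 0 < e ∧ ENNReal.ofReal e < ε := by
    obtain ⟨e, -, he⟩ := ENNReal.lt_iff_exists_real_btwn.1 hε
    exact ⟨e, ENNReal.ofReal_pos.1 he.1, he.2⟩
  obtain ⟨η, hη, hηe⟩ : ∃ η : ℝ, 0 < η ∧ a * (η * (1 + M)) ≤ e / 2 := by
    -- The summand `1` keeps the denominator positive when `a = 0`.
    refine ⟨e / (2 * (a * (1 + M) + 1)), by positivity, ?_⟩
    have h1 : 0 ≤ a * (1 + M) := by positivity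
    have h2 : a * (e / (2 * (a * (1 + M) + 1)) * (1 + M)) =
        e / 2 * ((a * (1 + M)) / (a * (1 + M) + 1)) := by
      field_simp
    rw [h2]
    refine mul_le_of_le_one_right (by positivity) ((div_le_one (by positivity)).2 (by linarith))
  have hlim : Tendsto (fun n => a * (η * (1 + M) + ‖s n - u n‖) + η * lam n * ‖s₀‖) atTop
      (𝓝 (a * (η * (1 + M)))) := by
    have := ((htau.const_add (η * (1 + M))).const_mul a).add
      ((hlam0.const_mul η).mul_const ‖s₀‖)
    simpa using this
  have hsmall := hlim.eventually (gt_mem_nhds (lt_of_le_of_lt hηe (half_lt_self he)))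
  have hp1 : Tendsto (fun n : ℕ => ENNReal.ofReal ((2 * (a * M)) ^ 2 / (n * (lam n * η) ^ 2)))
      atTop (𝓝 0) := by
    have h1 : Tendsto (fun n : ℕ => ((2 * (a * M)) ^ 2 / η ^ 2) * (2 / √((n : ℝ) + 1))) atTop
        (𝓝 0) := by
      have h2 : Tendsto (fun n : ℕ => √((n : ℝ) + 1)) atTop atTop :=
        Real.tendsto_sqrt_atTop.comp
          (tendsto_atTop_add_const_right _ _ tendsto_natCast_atTop_atTop)
      simpa using (h2.const_div_atTop 2).const_mul ((2 * (a * M)) ^ 2 / η ^ 2)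
    rw [← ENNReal.ofReal_zero]
    refine ENNReal.tendsto_ofReal (squeeze_zero' (Eventually.of_forall fun n => by positivity) ?_
      h1)
    filter_upwards [eventually_ge_atTop 1] with n hn
    have hn' : (1 : ℝ) ≤ n := by exact_mod_cast hn
    set q := √((n : ℝ) + 1)
    have hq : 0 < q := by positivity
    have hqq : q * q = n + 1 := Real.mul_self_sqrt (by positivity)
    -- From `lam n ^ 2 ≥ 1 / √(n + 1)` and `n ≥ (n + 1) / 2`. Thus `n lam²` diverges and the
    -- fluctuation is negligible against `lam`.
    have h3 : q / 2 ≤ n * lam n ^ 2 := by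
      calc q / 2 = (q * q) / 2 * (1 / q) := by field_simp
        _ ≤ n * (1 / q) := by
          refine mul_le_mul_of_nonneg_right ?_ (by positivity)
          rw [hqq]; linarith
        _ ≤ n * lam n ^ 2 := mul_le_mul_of_nonneg_left (hlamsq n) (by positivity)
    calc (2 * (a * M)) ^ 2 / (n * (lam n * η) ^ 2) =
        ((2 * (a * M)) ^ 2 / η ^ 2) * (1 / (n * lam n ^ 2)) := by
          have := (hlam n).ne'
          field_simp
      _ ≤ ((2 * (a * M)) ^ 2 / η ^ 2) * (1 / (q / 2)) := by gcongr
      _ = _ := by rw [one_div_div]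
  have hp2 := hrate η hη
  have hsum := hp1.add hp2
  rw [add_zero] at hsum
  refine tendsto_of_tendsto_of_tendsto_of_le_of_le' tendsto_const_nhds hsum
    (Eventually.of_forall fun _ => zero_le) ?_
  filter_upwards [hsmall, eventually_ne_atTop 0] with n hn hn0
  have hsub : {ω | ε ≤ ⨆ i : Fin n, rkhsNorm H₁ fun x : S =>
      scoreEstimator H (lam n) (fun i => X n i ω) (fun i => Bhat n i ω) (x, Bhat n i ω)
        - s₀ (x, B n i)} ⊆
      {ω | ¬ ∀ i, (X n i ω : Euc d) ∈ interior S} ∪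
      ({ω | lam n * η ≤ ‖(1 / (n : ℝ)) • ∑ i, f n i (X n i ω)‖} ∪
        {ω | ENNReal.ofReal (η * lam n) ≤ ⨆ i, ENNReal.ofReal
          (kernelDist (fun β β' : T => k₂ β β') (Bhat n i ω) (B n i))}) := by
    intro ω hω
    by_contra hnot
    have h1 : ∀ i, (X n i ω : Euc d) ∈ interior S := by
      by_contra h
      exact hnot (Or.inl h)
    have h2 : ‖(1 / (n : ℝ)) • ∑ i, f n i (X n i ω)‖ < lam n * η := by
      by_contra h
      exact hnot (Or.inr (Or.inl (not_lt.1 h)))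
    have h3 : ⨆ i, ENNReal.ofReal (kernelDist (fun β β' : T => k₂ β β') (Bhat n i ω) (B n i)) <
        ENNReal.ofReal (η * lam n) := by
      by_contra h
      exact hnot (Or.inr (Or.inr (not_lt.1 h)))
    have h4 : ∀ i, kernelDist (fun β β' : T => k₂ β β') (Bhat n i ω) (B n i) ≤ η * lam n :=
      fun i => (ENNReal.ofReal_le_ofReal_iff (mul_pos hη (hlam n)).le).1
        ((le_iSup (fun i => ENNReal.ofReal
          (kernelDist (fun β β' : T => k₂ β β') (Bhat n i ω) (B n i))) i).trans h3.le)
    have h5 := herr n hn0 η hη ω h1 h2.le h4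
    exact absurd hω (not_le.2 ((h5.trans (ENNReal.ofReal_le_ofReal hn.le)).trans_lt heε))
  -- Only monotonicity and subadditivity are used, so the argument applies to outer measure and the
  -- estimated vectors need not be measurable.
  refine (measure_mono hsub).trans ((measure_union_le _ _).trans ?_)
  rw [show P n {ω | ¬ ∀ i, (X n i ω : Euc d) ∈ interior S} = 0 from hint n, zero_add]
  refine (measure_union_le _ _).trans (add_le_add ?_ le_rfl)
  exact hcheb n _ (mul_pos (hlam n) hη)
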